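/- For a metric space $X$, $x\in X$, $\rho>0$ and $E\subset X$, let $B(x,\rho)$ be the closed ball of $X$ with centre $x$ and radius $\rho$, and let $N_\rho(E)$ be the least number of closed balls of $X$ of radius $\rho$ that cover $E$. For $0<\theta<1$ the lower spectrum of a non-empty metric space $X$ is $$\dim_{\mathrm L}^{\theta}X=\sup\Bigl\{s\ge 0:\ \exists\, C>0\ \forall\, 0<r<1,\ \ \inf_{x\in X}N_r\bigl(B(x,r^{\theta})\bigr)\ge C\Bigl(\frac{r^{\theta}}{r}\Bigr)^{s}\Bigr\}\in[0,\infty],$$ and at $\theta=1$ the expression $(1-\theta)\dim_{\mathrm L}^{\theta}X$ is understood to be $0$. A subset of $\mathbb{R}^d$ is regarded as a metric space with the Euclidean distance. For $\alpha\ge 0$ let $\mathcal H(\alpha)$ be the class of functions $\varphi:(0,1]\to[0,\alpha]$ such that for all $\lambda,\theta\in(0,1]$ both $\varphi(\lambda\theta)\ge\varphi(\theta)+\theta\varphi(\lambda)$ and $\varphi(\lambda\theta)\le(1-\theta)\alpha+\theta\varphi(\lambda)$. **Theorem.** Let $d\in\mathbb N$ and let $\varphi:(0,1]\to[0,d]$.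 Then there exists a non-empty set $F\subset\mathbb{R}^d$ such that $(1-\theta)\dim_{\mathrm L}^{\theta}F=\varphi(\theta)$ for all $\theta\in(0,1]$ if and only if $$\varphi(\theta)\le\varphi(\lambda\theta)-\theta\varphi(\lambda)\le(1-\theta)d\qquad\text{for all }\lambda,\theta\in(0,1].$$ Equivalently, the set of functions $\theta\mapsto(1-\theta)\dim_{\mathrm L}^{\theta}F$ on $(0,1]$, as $F$ ranges over the non-empty subsets of $\mathbb{R}^d$, is exactly $\mathcal H(d)$. -/

import Mathlib

open scoped NNReal ENNReal

noncomputable section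

/-- The lower spectrum of a metric space `X` at `θ`: the supremum of all `s ≥ 0` for which there is
`C > 0` such that, for every `0 < r < 1`, every closed ball `B(x, r ^ θ)` of `X` needs at least
`C (r ^ θ / r) ^ s` closed balls of radius `r` of `X` to be covered. The value is an extended
nonnegative real. `Metric.externalCoveringNumber r E` is the least number of closed balls of
radius `r`, centred anywhere in the ambient space `X`, that cover `E`. -/
def lowerSpectrum (X : Type*) [MetricSpace X] (θ : ℝ) : ℝ≥0∞ :=
  ⨆ (s : ℝ≥0) (_ : ∃ C : ℝ≥0, 0 < C ∧ ∀ r : ℝ≥0, 0 < r → r < 1 →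
      ((C * (r ^ θ / r) ^ (s : ℝ) : ℝ≥0) : ℝ≥0∞) ≤
        ⨅ x : X, ((Metric.externalCoveringNumber r
          (Metric.closedBall x ((r ^ θ : ℝ≥0) : ℝ)) : ℕ∞) : ℝ≥0∞)), (s : ℝ≥0∞)

/-- The normalized lower spectrum `θ ↦ (1 - θ) dim_L^θ X` on `(0, 1]`. The lower spectrum is only
considered for `θ < 1`; at `θ = 1` the normalized lower spectrum is `0` by convention. -/
def normalizedLowerSpectrum (X : Type*) [MetricSpace X] (θ : Set.Ioc (0 : ℝ) 1) : ℝ≥0∞ :=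
  if (θ : ℝ) = 1 then 0 else ENNReal.ofReal (1 - θ) * lowerSpectrum X θ

/-- The class `𝓗(α)` of functions `φ : (0, 1] → [0, α]` which are superadditive and weakly
Lipschitz. The product `l * θ` is the product of real numbers in `(0, 1]`. -/
def classH (α : ℝ) : Set (Set.Ioc (0 : ℝ) 1 → Set.Icc (0 : ℝ) α) :=
  {φ | (∀ l θ : Set.Ioc (0 : ℝ) 1, (φ (l * θ) : ℝ) ≥ φ θ + (θ : ℝ) * φ l) ∧
    (∀ l θ : Set.Ioc (0 : ℝ) 1, (φ (l * θ) : ℝ) ≤ (1 - (θ : ℝ)) * α + (θ : ℝ) * φ l)}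

end

/-!
If every ball of radius `r ^ θ` needs about `r ^ (-t)` balls of radius `r`, then
`t = (1 - θ) * s` for an exponent `s` admissible in the definition of the lower spectrum at `θ`, so
the normalized spectrum is the optimal `t`. Passing from scale `r ^ (l * θ)` to `r ^ θ` and then to
`r` multiplies covering numbers, which is superadditivity; the opposite inequality holds because the
step from `r ^ θ` to `r` costs at most a constant times `r ^ (-(1 - θ) * d)` in `ℝ ^ d`.

Conversely, put `g (u, v) = v * φ (u / v) / d`. The two inequalities say that `g` is superadditive
along `u ≤ v ≤ w` and that `g (u, ·)` increases at rate at most `1`. Hence for every `k` there are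
sets of binary expansions with `⌊g (k, n)⌋` free digits before position `n`. Such a set is nearly
optimal at scale `2 ^ (-k)` around one point, and superadditivity makes it branch at least as fast
as prescribed around every point and scale below `2 ^ (-k)`; expansions with a nonzero digit before
position `k` are left unrestricted, so no ball of radius above `2 ^ (-k)` is too thin. The disjoint
union of these sets over `k` has spectrum `φ / d`, and its `d`-th power has spectrum `φ`.
-/

open Filter Metric Set Topology

section Covering

variable {X : Type*} [PseudoMetricSpace X]

/-- The least number of closed balls of radius `r`, centred anywhere in `X`, that cover the closed
ball of centre `x` and radius `ρ`. -/
noncomputable def ballCoverNumber (r : ℝ≥0) (x : X) (ρ : ℝ≥0) : ℝ≥0∞ :=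
  (externalCoveringNumber r (closedBall x (ρ : ℝ)) : ℕ∞)

theorem exists_isCover_encard_eq_externalCoveringNumber (r : ℝ≥0) (E : Set X) :
    ∃ C, IsCover r E C ∧ C.encard = externalCoveringNumber r E := by
  have : Nonempty {C : Set X // IsCover r E C} := ⟨E, .rfl⟩
  obtain ⟨⟨C, hC⟩, hcard⟩ := ciInf_mem fun C : {C : Set X // IsCover r E C} => C.1.encard
  exact ⟨C, hC, hcard.trans iInf_subtype⟩

theorem ballCoverNumber_mono {r r' ρ ρ' : ℝ≥0} (hr : r' ≤ r) (hρ : ρ ≤ ρ') (x : X) :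
    ballCoverNumber r x ρ ≤ ballCoverNumber r' x ρ' :=
  ENat.toENNReal_le.2 <| (externalCoveringNumber_anti hr).trans <|
    externalCoveringNumber_mono_set <| closedBall_subset_closedBall <| NNReal.coe_le_coe.2 hρ

theorem one_le_ballCoverNumber (r ρ : ℝ≥0) (x : X) : 1 ≤ ballCoverNumber r x ρ := by
  have hne : (closedBall x (ρ : ℝ)).Nonempty := ⟨x, mem_closedBall_self ρ.2⟩
  have := Order.one_le_iff_pos.2 (externalCoveringNumber_pos_iff (ε := r).2 hne)
  exact ENat.toENNReal_one.symm.trans_le (ENat.toENNReal_le.2 this)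

theorem ballCoverNumber_self_le_one (r : ℝ≥0) (x : X) : ballCoverNumber r x r ≤ 1 := by
  have hcover : IsCover r (closedBall x (r : ℝ)) {x} := by
    simp [isCover_iff_subset_iUnion_closedBall]
  have := hcover.externalCoveringNumber_le_encard
  rw [encard_singleton] at this
  exact (ENat.toENNReal_le.2 this).trans_eq ENat.toENNReal_one

theorem externalCoveringNumber_le_mul_of_ballCoverNumber_le {r s : ℝ≥0} {M : ℝ≥0∞} (E : Set X)
    (hM : ∀ y : X, ballCoverNumber r y s ≤ M) :
    (externalCoveringNumber r E : ℝ≥0∞) ≤ externalCoveringNumber s E * M := by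
  obtain ⟨C, hC, hCcard⟩ := exists_isCover_encard_eq_externalCoveringNumber s E
  choose D hD hDcard using fun y : X =>
    exists_isCover_encard_eq_externalCoveringNumber r (closedBall y (s : ℝ))
  have hcover : IsCover r E (⋃ y ∈ C, D y) := fun x hx => by
    obtain ⟨y, hy, hxy⟩ := hC hx
    obtain ⟨z, hz, hxz⟩ := hD y (mem_closedBall.2 (edist_le_coe.1 hxy))
    exact ⟨z, mem_biUnion hy hz, hxz⟩
  calc (externalCoveringNumber r E : ℝ≥0∞)
      ≤ (⋃ y ∈ C, D y).encard := ENat.toENNReal_le.2 hcover.externalCoveringNumber_le_encard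
    _ = ∑' _ : ⋃ y ∈ C, D y, (1 : ℝ≥0∞) := (ENNReal.tsum_set_one _).symm
    _ ≤ ∑' y : C, ∑' _ : D y, (1 : ℝ≥0∞) := ENNReal.tsum_biUnion_le_tsum (fun _ => 1) C D
    _ ≤ ∑' _ : C, M := ENNReal.tsum_le_tsum fun y => by
        rw [ENNReal.tsum_set_one, hDcard]
        exact hM y
    _ = externalCoveringNumber s E * M := by rw [ENNReal.tsum_set_const, hCcard]

theorem card_le_ballCoverNumber {ι : Type*} [Fintype ι] {r ρ : ℝ≥0} {x : X} {p : ι → X}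
    (hp : ∀ i, p i ∈ closedBall x (ρ : ℝ)) (hsep : Pairwise fun i j => 2 * r < nndist (p i) (p j)) :
    (Fintype.card ι : ℝ≥0∞) ≤ ballCoverNumber r x ρ := by
  have hinj : Function.Injective p := fun i j hij => by
    by_contra hne
    simpa [hij] using hsep hne
  have hrange : IsSeparated (2 * r : ℝ≥0) (range p) := by
    rintro _ ⟨i, rfl⟩ _ ⟨j, rfl⟩ hij
    rw [edist_nndist, ENNReal.coe_lt_coe]
    exact hsep fun h => hij (congrArg p h)
  calc (Fintype.card ι : ℝ≥0∞) = (range p).encard := by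
        rw [← image_univ, hinj.encard_image, encard_univ, ENat.card_eq_coe_fintype_card,
          ENat.toENNReal_coe]
    _ ≤ ballCoverNumber r x ρ := ENat.toENNReal_le.2 <|
        (hrange.encard_le_packingNumber (range_subset_iff.2 hp)).trans
          (packingNumber_two_mul_le_externalCoveringNumber _ _)

theorem pairwiseDisjoint_closedBall_of_isSeparated {s : ℝ≥0} {C : Set X}
    (hC : IsSeparated (2 * s : ℝ≥0) C) : C.PairwiseDisjoint fun p => closedBall p (s : ℝ) := by
  intro p hp q hq hpq
  refine closedBall_disjoint_closedBall ?_
  have : ((2 * s : ℝ≥0) : ℝ) < dist p q := by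
    simpa only [edist_nndist, ENNReal.coe_lt_coe, ← NNReal.coe_lt_coe, coe_nndist]
      using hC hp hq hpq
  rwa [NNReal.coe_mul, NNReal.coe_ofNat, two_mul] at this

/-- The balls of radius `2 * s` around `4 * s`-separated points are disjoint, so a cover by small
balls splits into disjoint parts, one for each of the points. -/
theorem ballCoverNumber_mul_le {r s : ℝ≥0} {a : ℝ≥0∞} (hrs : r ≤ s)
    (ha : ∀ y : X, a ≤ ballCoverNumber r y s) (x : X) (ρ : ℝ≥0) :
    ballCoverNumber (4 * s) x ρ * a ≤ ballCoverNumber r x (ρ + s) := by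
  obtain ⟨D, hD, hDcard⟩ := exists_isCover_encard_eq_externalCoveringNumber r
    (closedBall x ((ρ + s : ℝ≥0) : ℝ))
  have hcover {p : X} (hp : p ∈ closedBall x (ρ : ℝ)) :
      IsCover r (closedBall p (s : ℝ)) (D ∩ closedBall p ((2 * s : ℝ≥0) : ℝ)) := fun y hy => by
    obtain ⟨z, hz, hyz⟩ := hD (closedBall_subset_closedBall' (by
      rw [NNReal.coe_add, add_comm]; gcongr; exact hp) hy)
    refine ⟨z, ⟨hz, ?_⟩, hyz⟩
    calc dist z p ≤ dist y z + dist y p := dist_triangle_left z p y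
      _ ≤ r + s := add_le_add (edist_le_coe.1 hyz) hy
      _ ≤ (2 * s : ℝ≥0) := by rw [two_mul]; exact_mod_cast add_le_add_left hrs s
  have hsep (C : Set X) (hCx : C ⊆ closedBall x (ρ : ℝ)) (hC : IsSeparated (4 * s : ℝ≥0) C) :
      (C.encard : ℝ≥0∞) * a ≤ D.encard := by
    have hdisj : C.PairwiseDisjoint fun p => D ∩ closedBall p ((2 * s : ℝ≥0) : ℝ) :=
      (pairwiseDisjoint_closedBall_of_isSeparated (by rwa [show 2 * (2 * s) = 4 * s by ring])).mono
        fun _ => inter_subset_right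
    calc (C.encard : ℝ≥0∞) * a
        = ∑' _ : C, a := (ENNReal.tsum_set_const _ _).symm
      _ ≤ ∑' p : C, ∑' _ : ↥(D ∩ closedBall (p : X) ((2 * s : ℝ≥0) : ℝ)), (1 : ℝ≥0∞) :=
          ENNReal.tsum_le_tsum fun p => by
            rw [ENNReal.tsum_set_one]
            exact (ha p).trans
              (ENat.toENNReal_le.2 (hcover (hCx p.2)).externalCoveringNumber_le_encard)
      _ = ∑' _ : ⋃ p ∈ C, D ∩ closedBall p ((2 * s : ℝ≥0) : ℝ), (1 : ℝ≥0∞) :=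
          (ENNReal.tsum_biUnion' (f := fun _ => 1) hdisj).symm
      _ ≤ D.encard := by
          rw [ENNReal.tsum_set_one]
          exact ENat.toENNReal_le.2 (encard_le_encard (iUnion₂_subset fun _ _ => inter_subset_left))
  calc ballCoverNumber (4 * s) x ρ * a
      ≤ (packingNumber (4 * s) (closedBall x (ρ : ℝ)) : ℝ≥0∞) * a := by
        gcongr
        exact ENat.toENNReal_le.2 <| (externalCoveringNumber_le_coveringNumber _ _).trans <|
          coveringNumber_le_packingNumber _ _
    _ ≤ D.encard := by
        simp only [packingNumber, ENat.toENNReal_iSup, ENNReal.iSup_mul, iSup_le_iff]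
        exact hsep
    _ = ballCoverNumber r x (ρ + s) := by rw [hDcard, ballCoverNumber]

end Covering

section AssouadExponent

/-- `α` is an exponent of homogeneity of `X`: the Assouad dimension of `X` is the infimum of the
`α` with this property. -/
def IsAssouadExponent (X : Type*) [MetricSpace X] (α : ℝ) : Prop :=
  ∃ M : ℝ≥0, 0 < M ∧ ∀ (x : X) (r ρ : ℝ≥0), 0 < r → r ≤ ρ →
    ballCoverNumber r x ρ ≤ (M * (ρ / r) ^ α : ℝ≥0)

variable {X Y : Type*} [MetricSpace X] [MetricSpace Y]

theorem ballCoverNumber_le_of_bilipschitz {f : Y → X} {K K' : ℝ≥0} (hf : LipschitzWith K f)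
    (hf' : AntilipschitzWith K' f) (hK' : 0 < K') (r ρ : ℝ≥0) (y : Y) :
    ballCoverNumber r y ρ ≤ ballCoverNumber (r / (2 * K')) (f y) (K * ρ) := by
  have hpack : packingNumber r (closedBall y (ρ : ℝ)) ≤
      packingNumber (2 * (r / (2 * K'))) (closedBall (f y) ((K * ρ : ℝ≥0) : ℝ)) := by
    refine iSup₂_le fun C hCy => iSup_le fun hC => ?_
    rw [← hf'.injective.encard_image]
    refine IsSeparated.encard_le_packingNumber
      (image_subset_iff.2 fun z hz => hf.mapsTo_closedBall y ρ (hCy hz)) ?_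
    rw [show 2 * (r / (2 * K')) = r / K' by field_simp]
    exact hC.image_antilipschitz hf' hK'
  exact ENat.toENNReal_le.2 <| (externalCoveringNumber_le_coveringNumber _ _).trans <|
    (coveringNumber_le_packingNumber _ _).trans <|
    hpack.trans (packingNumber_two_mul_le_externalCoveringNumber _ _)

theorem ballCoverNumber_le_of_bilipschitz_surjective {f : X → Y} {K K' : ℝ≥0} (hK : 0 < K)
    (hf : LipschitzWith K f) (hf' : AntilipschitzWith K' f) (hsurj : Function.Surjective f)
    (r ρ : ℝ≥0) (x : X) :
    ballCoverNumber (K' * r) x (ρ / K) ≤ ballCoverNumber r (f x) ρ := by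
  obtain ⟨D, hD, hDcard⟩ := exists_isCover_encard_eq_externalCoveringNumber r
    (closedBall (f x) (ρ : ℝ))
  set g := Function.surjInv hsurj
  have hg : LipschitzWith K' g := hf'.to_rightInverse (Function.rightInverse_surjInv hsurj)
  have hsub : closedBall x ((ρ / K : ℝ≥0) : ℝ) ⊆ g '' closedBall (f x) (ρ : ℝ) := fun z hz => by
    refine ⟨f z, ?_, Function.leftInverse_surjInv ⟨hf'.injective, hsurj⟩ z⟩
    have := hf.mapsTo_closedBall x _ hz
    rwa [← NNReal.coe_mul, mul_div_cancel₀ _ hK.ne'] at this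
  exact ENat.toENNReal_le.2 <|
    ((hD.image_lipschitz hg).anti hsub).externalCoveringNumber_le_encard.trans <|
      (encard_image_le g D).trans hDcard.le

theorem IsAssouadExponent.of_bilipschitz {α : ℝ} (hX : IsAssouadExponent X α) {f : Y → X}
    {K K' : ℝ≥0} (hf : LipschitzWith K f) (hf' : AntilipschitzWith K' f) :
    IsAssouadExponent Y α := by
  obtain ⟨M, hM, hX⟩ := hX
  obtain ⟨L, hL, hL'⟩ : ∃ L : ℝ≥0, 1 ≤ L ∧ LipschitzWith L f :=
    ⟨max 1 K, le_max_left _ _, hf.weaken (le_max_right _ _)⟩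
  obtain ⟨A, hA, hA'⟩ : ∃ A : ℝ≥0, 1 ≤ A ∧ AntilipschitzWith A f :=
    ⟨max 1 K', le_max_left _ _, fun x y => (hf' x y).trans (by gcongr; exact le_max_right _ _)⟩
  have hA0 : 0 < A := one_pos.trans_le hA
  have hL0 : 0 < L := one_pos.trans_le hL
  refine ⟨M * (L * (2 * A)) ^ α, mul_pos hM (NNReal.rpow_pos (mul_pos hL0 (mul_pos two_pos hA0))),
    fun y r ρ hr hrρ => ?_⟩
  calc ballCoverNumber r y ρ
      ≤ ballCoverNumber (r / (2 * A)) (f y) (L * ρ) :=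
        ballCoverNumber_le_of_bilipschitz hL' hA' hA0 r ρ y
    _ ≤ (M * (L * ρ / (r / (2 * A))) ^ α : ℝ≥0) := by
        refine hX _ _ _ (by positivity) ?_
        calc r / (2 * A) ≤ r := div_le_self zero_le (by linarith)
          _ ≤ L * ρ := hrρ.trans (le_mul_of_one_le_left zero_le hL)
    _ = (M * (L * (2 * A)) ^ α * (ρ / r) ^ α : ℝ≥0) := by
        rw [mul_assoc, ← NNReal.mul_rpow]
        congr 3
        field_simp

theorem ballCoverNumber_pi_le {ι : Type*} [Fintype ι] (r ρ : ℝ≥0) (x : ι → X) :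
    ballCoverNumber r x ρ ≤ ∏ i, ballCoverNumber r (x i) ρ := by
  choose C hC hCcard using fun i =>
    exists_isCover_encard_eq_externalCoveringNumber r (closedBall (x i) (ρ : ℝ))
  have hcover : IsCover r (closedBall x (ρ : ℝ)) (univ.pi C) := fun y hy => by
    rw [closedBall_pi x ρ.coe_nonneg] at hy
    choose z hz hyz using fun i => hC i (hy i (mem_univ i))
    exact ⟨z, fun i _ => hz i, edist_pi_le_iff.2 hyz⟩
  simp only [ballCoverNumber, ← hCcard]
  refine (ENat.toENNReal_le.2 hcover.externalCoveringNumber_le_encard).trans_eq ?_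
  rw [encard_pi_eq_prod_encard]
  exact map_prod ENat.toENNRealRingHom _ _

theorem isSeparated_pi {ι : Type*} [Fintype ι] {ε : ℝ≥0∞} {C : ι → Set X}
    (hC : ∀ i, IsSeparated ε (C i)) : IsSeparated ε (univ.pi C) := fun y hy z hz hyz => by
  obtain ⟨i, hi⟩ := Function.ne_iff.1 hyz
  exact (hC i (hy i (mem_univ i)) (hz i (mem_univ i)) hi).trans_le (edist_le_pi_edist y z i)

theorem prod_ballCoverNumber_two_mul_le {ι : Type*} [Fintype ι] {r ρ : ℝ≥0} (x : ι → X)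
    (hfin : ∀ i, ballCoverNumber r (x i) ρ ≠ ⊤) :
    ∏ i, ballCoverNumber (2 * r) (x i) ρ ≤ ballCoverNumber r x ρ := by
  have hpack (i : ι) : packingNumber (2 * r) (closedBall (x i) (ρ : ℝ)) ≠ ⊤ :=
    ne_top_of_le_ne_top (ENat.toENNReal_ne_top.1 (hfin i))
      (packingNumber_two_mul_le_externalCoveringNumber _ _)
  choose C hCsub _ hCsep hCcard using fun i => exists_set_encard_eq_packingNumber (hpack i)
  have hsub : univ.pi C ⊆ closedBall x (ρ : ℝ) := by
    rw [closedBall_pi x ρ.coe_nonneg]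
    exact pi_mono fun i _ => hCsub i
  calc ∏ i, ballCoverNumber (2 * r) (x i) ρ ≤ ∏ i, ((C i).encard : ℝ≥0∞) :=
        Finset.prod_le_prod' fun i _ => ENat.toENNReal_le.2 <| hCcard i ▸
          (externalCoveringNumber_le_coveringNumber _ _).trans (coveringNumber_le_packingNumber _ _)
    _ = (univ.pi C).encard := by
        rw [encard_pi_eq_prod_encard]
        exact (map_prod ENat.toENNRealRingHom _ _).symm
    _ ≤ ballCoverNumber r x ρ := ENat.toENNReal_le.2 <|
        ((isSeparated_pi hCsep).encard_le_packingNumber hsub).trans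
          (packingNumber_two_mul_le_externalCoveringNumber _ _)

theorem IsAssouadExponent.ballCoverNumber_ne_top {α : ℝ} (hX : IsAssouadExponent X α) {r : ℝ≥0}
    (hr : 0 < r) (x : X) (ρ : ℝ≥0) : ballCoverNumber r x ρ ≠ ⊤ := by
  obtain ⟨M, -, hX⟩ := hX
  exact ne_top_of_le_ne_top ENNReal.coe_ne_top
    ((ballCoverNumber_mono le_rfl (le_max_left ρ r) x).trans (hX x r _ hr (le_max_right ρ r)))

theorem IsAssouadExponent.pi {ι : Type*} [Fintype ι] {α : ℝ} (hX : IsAssouadExponent X α) :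
    IsAssouadExponent (ι → X) (Fintype.card ι * α) := by
  obtain ⟨M, hM, hX⟩ := hX
  refine ⟨M ^ Fintype.card ι, by positivity, fun x r ρ hr hrρ => ?_⟩
  calc ballCoverNumber r x ρ
      ≤ ∏ i, ballCoverNumber r (x i) ρ := ballCoverNumber_pi_le r ρ x
    _ ≤ ∏ _ : ι, ((M * (ρ / r) ^ α : ℝ≥0) : ℝ≥0∞) :=
        Finset.prod_le_prod' fun i _ => hX (x i) r ρ hr hrρ
    _ = (M ^ Fintype.card ι * (ρ / r) ^ (Fintype.card ι * α) : ℝ≥0) := by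
        rw [Finset.prod_const, Finset.card_univ, ← ENNReal.coe_pow, mul_pow, mul_comm (_ : ℝ) α,
          NNReal.rpow_mul, NNReal.rpow_natCast]

theorem isAssouadExponent_real : IsAssouadExponent ℝ 1 := by
  refine ⟨3, by norm_num, fun x r ρ hr hrρ => ?_⟩
  have hr' : (0 : ℝ) < r := hr
  set n := ⌊2 * (ρ : ℝ) / r⌋₊ + 1 with hn
  have hcover : IsCover r (closedBall x (ρ : ℝ))
      ((Finset.range n).image fun k : ℕ => x - ρ + k * r : Finset ℝ) := fun y hy => by
    rw [mem_closedBall, Real.dist_eq, abs_le] at hy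
    have hpos : 0 ≤ (y - (x - ρ)) / r := div_nonneg (by linarith) hr'.le
    refine ⟨x - ρ + ⌊(y - (x - ρ)) / r⌋₊ * r, ?_, ?_⟩
    · refine Finset.mem_coe.2 (Finset.mem_image_of_mem _ (Finset.mem_range_succ_iff.2 ?_))
      gcongr
      linarith
    · have hle := Nat.floor_le hpos
      have hlt := Nat.lt_floor_add_one ((y - (x - ρ)) / r)
      rw [le_div_iff₀ hr'] at hle
      rw [div_lt_iff₀ hr'] at hlt
      refine edist_le_coe.2 (NNReal.coe_le_coe.1 ?_)
      rw [coe_nndist, Real.dist_eq, abs_le]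
      constructor <;> linarith
  calc ballCoverNumber r x ρ
      ≤ (n : ℝ≥0) := by
        have := hcover.externalCoveringNumber_le_encard
        rw [encard_coe_eq_coe_finsetCard] at this
        have := this.trans (Nat.cast_le.2 (Finset.card_image_le.trans_eq (Finset.card_range n)))
        exact (ENat.toENNReal_le.2 this).trans_eq (by simp)
    _ ≤ (3 * (ρ / r) ^ (1 : ℝ) : ℝ≥0) := by
        rw [NNReal.rpow_one, ENNReal.coe_le_coe]
        have h1 : (1 : ℝ) ≤ ρ / r := (one_le_div hr').2 hrρ
        have hfloor : (⌊2 * (ρ : ℝ) / r⌋₊ : ℝ) ≤ 2 * ρ / r := Nat.floor_le (by positivity)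
        rw [← NNReal.coe_le_coe, hn]
        push_cast
        linarith [mul_div_assoc 2 (ρ : ℝ) r]

theorem isAssouadExponent_subset_real (S : Set ℝ) : IsAssouadExponent S 1 :=
  isAssouadExponent_real.of_bilipschitz (LipschitzWith.subtype_val S)
    isometry_subtype_coe.antilipschitz

theorem isAssouadExponent_subset_euclideanSpace {ι : Type*} [Fintype ι]
    (F : Set (EuclideanSpace ℝ ι)) : IsAssouadExponent F (Fintype.card ι) := by
  have hpi := isAssouadExponent_real.pi (ι := ι)
  rw [mul_one] at hpi
  exact (hpi.of_bilipschitz (PiLp.lipschitzWith_ofLp 2 _)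
    (PiLp.antilipschitzWith_ofLp 2 _)).of_bilipschitz
    (LipschitzWith.subtype_val F) isometry_subtype_coe.antilipschitz

end AssouadExponent

theorem le_of_frequently_mul_rpow_neg_le {C M : ℝ≥0} (hC : 0 < C) {t u : ℝ}
    (h : ∃ᶠ r : ℝ≥0 in 𝓝[>] 0, C * r ^ (-t) ≤ M * r ^ (-u)) : t ≤ u := by
  by_contra! hut
  have hlim : Tendsto (fun r : ℝ≥0 => M * r ^ (t - u)) (𝓝[>] 0) (𝓝 0) := by
    have hcont : ContinuousAt (fun r : ℝ≥0 => M * r ^ (t - u)) 0 :=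
      continuousAt_const.mul (NNReal.continuousAt_rpow_const (.inr (sub_nonneg.2 hut.le)))
    simpa [ContinuousAt, NNReal.zero_rpow (sub_pos.2 hut).ne'] using
      hcont.tendsto.mono_left nhdsWithin_le_nhds
  refine h ?_
  filter_upwards [hlim.eventually_lt_const hC, self_mem_nhdsWithin] with r hlt hr
  rw [not_le]
  have hr0 : r ≠ 0 := (mem_Ioi.1 hr).ne'
  calc M * r ^ (-u) = M * r ^ (t - u) * r ^ (-t) := by
        rw [mul_assoc, ← NNReal.rpow_add hr0]
        ring_nf
    _ < C * r ^ (-t) := by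
        gcongr

section LowerExponent

/-- Every ball of radius `b * r ^ θ` needs at least a constant times `r ^ (-t)` balls of radius
`a * r` to be covered. For `a = b = 1` and `t = (1 - θ) * s` this is the condition on `s` in the
definition of the lower spectrum at `θ`. -/
def IsLowerExponent (X : Type*) [MetricSpace X] (a b : ℝ≥0) (θ t : ℝ) : Prop :=
  ∃ C : ℝ≥0, 0 < C ∧ ∀ r : ℝ≥0, 0 < r → r < 1 → ∀ x : X,
    (C * r ^ (-t) : ℝ≥0) ≤ ballCoverNumber (a * r) x (b * r ^ θ)

namespace IsLowerExponent

variable {X Y : Type*} [MetricSpace X] [MetricSpace Y] {a b a' b' : ℝ≥0} {θ l t u α : ℝ}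

theorem zero_exponent : IsLowerExponent X a b θ 0 :=
  ⟨1, one_pos, fun r _ _ x => by simpa using one_le_ballCoverNumber (a * r) (b * r ^ θ) x⟩

theorem rescale (hX : IsAssouadExponent X α) (hθ : 0 < θ) (ha : 0 < a) (ha' : 0 < a')
    (hb : 0 < b) (hb' : 0 < b') (h : IsLowerExponent X a b θ t) :
    IsLowerExponent X a' b' θ t := by
  obtain ⟨M, hM, hX⟩ := hX
  obtain ⟨C, hC, h⟩ := h
  obtain ⟨κ, hκ, hκ1, hκa, hκb⟩ :
      ∃ κ : ℝ≥0, 0 < κ ∧ κ ≤ 1 ∧ a * κ ≤ a' ∧ b * κ ^ θ ≤ b' := by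
    refine ⟨min 1 (min (a' / a) ((b' / b) ^ θ⁻¹)), by positivity, min_le_left _ _, ?_, ?_⟩
    · rw [mul_comm, ← le_div_iff₀ ha]
      exact (min_le_right _ _).trans (min_le_left _ _)
    · rw [mul_comm, ← le_div_iff₀ hb, ← NNReal.le_rpow_inv_iff hθ]
      exact (min_le_right _ _).trans (min_le_right _ _)
  set K := M * (a' / (a * κ)) ^ α with hK
  have hKpos : 0 < K := by positivity
  refine ⟨C * κ ^ (-t) / K, by positivity, fun r hr hr1 x => ?_⟩
  have hsmall (y : X) : ballCoverNumber (a * (κ * r)) y (a' * r) ≤ K := by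
    refine (hX y _ _ (by positivity) ?_).trans_eq ?_
    · rw [← mul_assoc]
      gcongr
    · rw [hK]
      congr 3
      field_simp
  have hmul : ((C * (κ * r) ^ (-t) : ℝ≥0) : ℝ≥0∞) ≤
      ballCoverNumber (a' * r) x (b' * r ^ θ) * K := by
    refine (h (κ * r) (by positivity) (mul_lt_one_of_nonneg_of_lt_one_right hκ1 zero_le hr1)
      x).trans ?_
    refine (ballCoverNumber_mono le_rfl ?_ x).trans
      (externalCoveringNumber_le_mul_of_ballCoverNumber_le _ hsmall)
    rw [NNReal.mul_rpow, ← mul_assoc]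
    gcongr
  rw [div_mul_eq_mul_div, mul_assoc C, ← NNReal.mul_rpow, ENNReal.coe_div hKpos.ne']
  exact ENNReal.div_le_of_le_mul hmul

theorem le [Nonempty X] (hX : IsAssouadExponent X α) (hθ : θ ≤ 1)
    (h : IsLowerExponent X 1 1 θ t) : t ≤ (1 - θ) * α := by
  obtain ⟨M, -, hX⟩ := hX
  obtain ⟨C, hC, h⟩ := h
  obtain ⟨x⟩ := ‹Nonempty X›
  refine le_of_frequently_mul_rpow_neg_le (M := M) hC (Eventually.frequently ?_)
  filter_upwards [Ioo_mem_nhdsGT one_pos] with r ⟨hr, hr1⟩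
  have hrθ : r ≤ r ^ θ := by
    simpa using NNReal.rpow_le_rpow_of_exponent_ge hr hr1.le hθ
  have hle := (h r hr hr1 x).trans (by simpa using hX x r (r ^ θ) hr hrθ)
  refine (ENNReal.coe_le_coe.1 hle).trans_eq ?_
  nth_rw 2 [← NNReal.rpow_one r]
  rw [← NNReal.rpow_sub hr.ne', ← NNReal.rpow_mul]
  congr 2
  ring

theorem of_mul (hX : IsAssouadExponent X α) (hθ : 0 < θ) (hθ1 : θ ≤ 1)
    (h : IsLowerExponent X 1 1 (l * θ) t) : IsLowerExponent X 1 1 l ((t - (1 - θ) * α) / θ) := by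
  obtain ⟨M, hM, hX⟩ := hX
  obtain ⟨C, hC, h⟩ := h
  refine ⟨C / M, by positivity, fun s hs hs1 x => ?_⟩
  set r := s ^ θ⁻¹ with hr
  have hr0 : 0 < r := NNReal.rpow_pos hs
  have hr1 : r < 1 := NNReal.rpow_lt_one hs1 (inv_pos.2 hθ)
  have hrs : r ≤ s := by
    simpa using NNReal.rpow_le_rpow_of_exponent_ge hs hs1.le ((one_le_inv₀ hθ).2 hθ1)
  have hrl : r ^ (l * θ) = s ^ l := by
    rw [hr, ← NNReal.rpow_mul]
    congr 1
    field_simp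
  have hmul : ((C * r ^ (-t) : ℝ≥0) : ℝ≥0∞) ≤
      ballCoverNumber s x (s ^ l) * (M * (s / r) ^ α : ℝ≥0) := by
    have := h r hr0 hr1 x
    rw [one_mul, one_mul, hrl] at this
    exact this.trans
      (externalCoveringNumber_le_mul_of_ballCoverNumber_le _ fun y => hX y r s hr0 hrs)
  have hdiv : C / M * s ^ (-((t - (1 - θ) * α) / θ)) = C * r ^ (-t) / (M * (s / r) ^ α) := by
    rw [mul_div_mul_comm, hr]
    congr 1
    nth_rw 3 [← NNReal.rpow_one s]
    rw [← NNReal.rpow_sub hs.ne', ← NNReal.rpow_mul, ← NNReal.rpow_mul, ← NNReal.rpow_sub hs.ne']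
    congr 1
    field_simp
    ring
  rw [one_mul, one_mul, hdiv, ENNReal.coe_div (by positivity)]
  exact ENNReal.div_le_of_le_mul hmul

theorem add_mul (hX : IsAssouadExponent X α) (hl : 0 < l) (hl1 : l ≤ 1) (hθ : 0 < θ) (hθ1 : θ ≤ 1)
    (h : IsLowerExponent X 1 1 θ t) (h' : IsLowerExponent X 1 1 l u) :
    IsLowerExponent X 1 1 (l * θ) (t + θ * u) := by
  obtain ⟨C, hC, h⟩ := h
  obtain ⟨C', hC', h'⟩ := h'.rescale hX hl one_pos four_pos one_pos one_pos
  refine rescale (b := 2) hX (mul_pos hl hθ) one_pos one_pos two_pos one_pos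
    ⟨C * C', mul_pos hC hC', fun r hr hr1 x => ?_⟩
  set s := r ^ θ with hs
  have hs0 : 0 < s := NNReal.rpow_pos hr
  have hs1 : s < 1 := NNReal.rpow_lt_one hr1 hθ
  have hrs : r ≤ s := by simpa using NNReal.rpow_le_rpow_of_exponent_ge hr hr1.le hθ1
  have hssl : s ≤ s ^ l := by simpa using NNReal.rpow_le_rpow_of_exponent_ge hs0 hs1.le hl1
  have hbig := h' s hs0 hs1 x
  have hsmall (y : X) : ((C * r ^ (-t) : ℝ≥0) : ℝ≥0∞) ≤ ballCoverNumber r y s := by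
    simpa only [one_mul] using h r hr hr1 y
  calc ((C * C' * r ^ (-(t + θ * u)) : ℝ≥0) : ℝ≥0∞)
      = (C' * s ^ (-u) : ℝ≥0) * (C * r ^ (-t) : ℝ≥0) := by
        rw [← ENNReal.coe_mul, hs, ← NNReal.rpow_mul, mul_mul_mul_comm, ← NNReal.rpow_add hr.ne',
          mul_comm C C']
        congr 3
        ring
    _ ≤ ballCoverNumber (4 * s) x (s ^ l) * (C * r ^ (-t) : ℝ≥0) := by
        gcongr
        simpa only [one_mul] using hbig
    _ ≤ ballCoverNumber r x (s ^ l + s) := ballCoverNumber_mul_le hrs hsmall x _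
    _ ≤ ballCoverNumber (1 * r) x (2 * r ^ (l * θ)) := by
        refine ballCoverNumber_mono (one_mul r).le ?_ x
        rw [mul_comm l, NNReal.rpow_mul, two_mul]
        gcongr

theorem of_bilipschitz {f : X → Y} {K K' : ℝ≥0} (hK : 0 < K) (hf : LipschitzWith K f)
    (hf' : AntilipschitzWith K' f) (hsurj : Function.Surjective f)
    (h : IsLowerExponent X (K' * a) (b / K) θ t) : IsLowerExponent Y a b θ t := by
  obtain ⟨C, hC, h⟩ := h
  refine ⟨C, hC, fun r hr hr1 y => ?_⟩
  obtain ⟨x, rfl⟩ := hsurj y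
  refine (h r hr hr1 x).trans ?_
  rw [mul_assoc, div_mul_eq_mul_div]
  exact ballCoverNumber_le_of_bilipschitz_surjective hK hf hf' hsurj (a * r) (b * r ^ θ) x

theorem pi {ι : Type*} [Fintype ι] (hX : IsAssouadExponent X α) (h : IsLowerExponent X 2 1 θ t) :
    IsLowerExponent (ι → X) 1 1 θ (Fintype.card ι * t) := by
  obtain ⟨C, hC, h⟩ := h
  refine ⟨C ^ Fintype.card ι, by positivity, fun r hr hr1 x => ?_⟩
  calc ((C ^ Fintype.card ι * r ^ (-(Fintype.card ι * t)) : ℝ≥0) : ℝ≥0∞)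
      = ∏ _ : ι, ((C * r ^ (-t) : ℝ≥0) : ℝ≥0∞) := by
        rw [Finset.prod_const, Finset.card_univ, ← ENNReal.coe_pow, mul_pow, neg_mul_eq_mul_neg,
          mul_comm (_ : ℝ) (-t), NNReal.rpow_mul, NNReal.rpow_natCast]
    _ ≤ ∏ i, ballCoverNumber (2 * r) (x i) (1 * r ^ θ) :=
        Finset.prod_le_prod' fun i _ => h r hr hr1 (x i)
    _ ≤ ballCoverNumber (1 * r) x (1 * r ^ θ) := by
        rw [one_mul r]
        exact prod_ballCoverNumber_two_mul_le x fun i => hX.ballCoverNumber_ne_top hr (x i) _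

theorem of_pi {ι : Type*} [Fintype ι] [Nonempty ι] (h : IsLowerExponent (ι → X) a b θ t) :
    IsLowerExponent X a b θ (t / Fintype.card ι) := by
  obtain ⟨C, hC, h⟩ := h
  have hcard : Fintype.card ι ≠ 0 := Fintype.card_ne_zero
  refine ⟨C ^ (Fintype.card ι : ℝ)⁻¹, by positivity, fun r hr hr1 x => ?_⟩
  refine (ENNReal.pow_le_pow_left_iff hcard).1 ?_
  calc ((C ^ (Fintype.card ι : ℝ)⁻¹ * r ^ (-(t / Fintype.card ι)) : ℝ≥0) : ℝ≥0∞) ^ Fintype.card ι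
      = (C * r ^ (-t) : ℝ≥0) := by
        rw [← ENNReal.coe_pow, mul_pow, NNReal.rpow_inv_natCast_pow _ hcard, ← NNReal.rpow_natCast,
          ← NNReal.rpow_mul, ← neg_div, div_mul_cancel₀ _ (Nat.cast_ne_zero.2 hcard)]
    _ ≤ ballCoverNumber (a * r) (fun _ : ι => x) (b * r ^ θ) := h r hr hr1 _
    _ ≤ ballCoverNumber (a * r) x (b * r ^ θ) ^ Fintype.card ι :=
        (ballCoverNumber_pi_le _ _ _).trans_eq (by rw [Finset.prod_const, Finset.card_univ])

end IsLowerExponent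

end LowerExponent

section NormalizedLowerSpectrum

variable {X Y : Type*} [MetricSpace X] [MetricSpace Y] {α : ℝ}

theorem isLowerExponent_one_sub_mul_iff {θ s : ℝ} :
    IsLowerExponent X 1 1 θ ((1 - θ) * s) ↔
      ∃ C : ℝ≥0, 0 < C ∧ ∀ r : ℝ≥0, 0 < r → r < 1 →
        ((C * (r ^ θ / r) ^ s : ℝ≥0) : ℝ≥0∞) ≤
          ⨅ x : X, ((externalCoveringNumber r (closedBall x ((r ^ θ : ℝ≥0) : ℝ)) : ℕ∞) : ℝ≥0∞) := by
  refine exists_congr fun C => and_congr_right fun _ =>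
    forall_congr' fun r => imp_congr_right fun hr => imp_congr_right fun _ => ?_
  have hpow : r ^ (-((1 - θ) * s)) = (r ^ θ / r) ^ s := by
    nth_rw 3 [← NNReal.rpow_one r]
    rw [← NNReal.rpow_sub hr.ne', ← NNReal.rpow_mul]
    ring_nf
  simp only [one_mul, hpow, le_iInf_iff, ballCoverNumber]

theorem IsLowerExponent.nonpos [Nonempty X] {t : ℝ} (h : IsLowerExponent X 1 1 1 t) : t ≤ 0 := by
  obtain ⟨C, hC, h⟩ := h
  obtain ⟨x⟩ := ‹Nonempty X›
  refine le_of_frequently_mul_rpow_neg_le (M := 1) hC (Eventually.frequently ?_)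
  filter_upwards [Ioo_mem_nhdsGT one_pos] with r ⟨hr, hr1⟩
  have hle := h r hr hr1 x
  rw [one_mul, one_mul, NNReal.rpow_one] at hle
  simpa using ENNReal.coe_le_coe.1 (hle.trans (ballCoverNumber_self_le_one r x))

theorem normalizedLowerSpectrum_eq_iSup [Nonempty X] (θ : Ioc (0 : ℝ) 1) :
    normalizedLowerSpectrum X θ = ⨆ (t : ℝ≥0) (_ : IsLowerExponent X 1 1 θ t), (t : ℝ≥0∞) := by
  rcases θ.2.2.eq_or_lt with hθ | hθ
  · rw [normalizedLowerSpectrum, if_pos hθ, hθ]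
    refine le_antisymm zero_le (iSup₂_le fun t ht => ?_)
    exact_mod_cast ht.nonpos
  rw [normalizedLowerSpectrum, if_neg hθ.ne, lowerSpectrum]
  obtain ⟨u, hu⟩ : ∃ u : ℝ≥0, (u : ℝ) = 1 - θ := ⟨⟨1 - θ, sub_nonneg.2 hθ.le⟩, rfl⟩
  have hu0 : u ≠ 0 := NNReal.coe_ne_zero.1 (hu ▸ (sub_pos.2 hθ).ne')
  simp only [← isLowerExponent_one_sub_mul_iff, ENNReal.mul_iSup, ← hu, ENNReal.ofReal_coe_nnreal,
    ← ENNReal.coe_mul, ← NNReal.coe_mul]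
  exact (mul_left_surjective₀ hu0).iSup_comp
    (g := fun t : ℝ≥0 => ⨆ _ : IsLowerExponent X 1 1 θ t, (t : ℝ≥0∞))

theorem IsLowerExponent.ofReal_le [Nonempty X] {θ : Ioc (0 : ℝ) 1} {t : ℝ}
    (h : IsLowerExponent X 1 1 θ t) : ENNReal.ofReal t ≤ normalizedLowerSpectrum X θ := by
  rcases le_total t 0 with ht | ht
  · simp [ENNReal.ofReal_of_nonpos ht]
  · rw [normalizedLowerSpectrum_eq_iSup]
    exact le_iSup₂_of_le t.toNNReal (by rwa [Real.coe_toNNReal t ht]) le_rfl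

theorem normalizedLowerSpectrum_congr [Nonempty X] [Nonempty Y] {θ : Ioc (0 : ℝ) 1}
    (h : ∀ t, IsLowerExponent X 1 1 θ t ↔ IsLowerExponent Y 1 1 θ t) :
    normalizedLowerSpectrum X θ = normalizedLowerSpectrum Y θ := by
  simp only [normalizedLowerSpectrum_eq_iSup, h]

theorem normalizedLowerSpectrum_le [Nonempty X] (hX : IsAssouadExponent X α) (θ : Ioc (0 : ℝ) 1) :
    normalizedLowerSpectrum X θ ≤ ENNReal.ofReal ((1 - θ) * α) := by
  rw [normalizedLowerSpectrum_eq_iSup]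
  refine iSup₂_le fun t ht => ?_
  rw [← ENNReal.ofReal_coe_nnreal]
  exact ENNReal.ofReal_le_ofReal (ht.le hX θ.2.2)

theorem add_mul_le_normalizedLowerSpectrum_mul [Nonempty X] (hX : IsAssouadExponent X α)
    (l θ : Ioc (0 : ℝ) 1) :
    normalizedLowerSpectrum X θ + ENNReal.ofReal θ * normalizedLowerSpectrum X l ≤
      normalizedLowerSpectrum X (l * θ) := by
  have hzero (θ : ℝ) : IsLowerExponent X 1 1 θ (0 : ℝ≥0) := by
    simpa only [NNReal.coe_zero] using IsLowerExponent.zero_exponent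
  rw [normalizedLowerSpectrum_eq_iSup θ, normalizedLowerSpectrum_eq_iSup l]
  simp only [ENNReal.mul_iSup]
  refine ENNReal.biSup_add_biSup_le' ⟨(0 : ℝ≥0), hzero θ⟩ ⟨(0 : ℝ≥0), hzero l⟩
    fun (t : ℝ≥0) ht (u : ℝ≥0) hu => ?_
  have htu : IsLowerExponent X 1 1 (l * θ : Ioc (0 : ℝ) 1) (t + θ * u) :=
    ht.add_mul hX l.2.1 l.2.2 θ.2.1 θ.2.2 hu
  calc (t : ℝ≥0∞) + ENNReal.ofReal θ * u = ENNReal.ofReal (t + θ * u) := by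
        rw [ENNReal.ofReal_add t.coe_nonneg (mul_nonneg θ.2.1.le u.coe_nonneg),
          ENNReal.ofReal_mul θ.2.1.le, ENNReal.ofReal_coe_nnreal, ENNReal.ofReal_coe_nnreal]
    _ ≤ normalizedLowerSpectrum X (l * θ) := htu.ofReal_le

theorem normalizedLowerSpectrum_mul_le [Nonempty X] (hX : IsAssouadExponent X α)
    (l θ : Ioc (0 : ℝ) 1) :
    normalizedLowerSpectrum X (l * θ) ≤
      ENNReal.ofReal ((1 - θ) * α) + ENNReal.ofReal θ * normalizedLowerSpectrum X l := by
  rw [normalizedLowerSpectrum_eq_iSup]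
  refine iSup₂_le fun t ht => ?_
  have hl := (ht.of_mul hX θ.2.1 θ.2.2).ofReal_le
  calc (t : ℝ≥0∞) = ENNReal.ofReal ((1 - θ) * α + θ * ((t - (1 - θ) * α) / θ)) := by
        rw [mul_div_cancel₀ _ θ.2.1.ne', add_sub_cancel, ENNReal.ofReal_coe_nnreal]
    _ ≤ ENNReal.ofReal ((1 - θ) * α) + ENNReal.ofReal (θ * ((t - (1 - θ) * α) / θ)) :=
        ENNReal.ofReal_add_le
    _ ≤ ENNReal.ofReal ((1 - θ) * α) + ENNReal.ofReal θ * normalizedLowerSpectrum X l := by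
        rw [ENNReal.ofReal_mul θ.2.1.le]
        gcongr

theorem exists_mem_classH_normalizedLowerSpectrum_eq [Nonempty X] (hX : IsAssouadExponent X α)
    (hα : 0 ≤ α) : ∃ φ ∈ classH α, ∀ θ, normalizedLowerSpectrum X θ = ENNReal.ofReal (φ θ) := by
  have hle (θ : Ioc (0 : ℝ) 1) := normalizedLowerSpectrum_le hX θ
  have hfin (θ : Ioc (0 : ℝ) 1) : normalizedLowerSpectrum X θ ≠ ⊤ :=
    ne_top_of_le_ne_top ENNReal.ofReal_ne_top (hle θ)
  have hnonneg (θ : Ioc (0 : ℝ) 1) : 0 ≤ (1 - (θ : ℝ)) * α :=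
    mul_nonneg (sub_nonneg.2 θ.2.2) hα
  refine ⟨fun θ => ⟨(normalizedLowerSpectrum X θ).toReal, ENNReal.toReal_nonneg, ?_⟩,
    ⟨fun l θ => ?_, fun l θ => ?_⟩, fun θ => (ENNReal.ofReal_toReal (hfin θ)).symm⟩
  · refine (ENNReal.toReal_le_of_le_ofReal (hnonneg θ) (hle θ)).trans ?_
    exact mul_le_of_le_one_left hα (sub_le_self 1 θ.2.1.le)
  · have := ENNReal.toReal_mono (hfin _) (add_mul_le_normalizedLowerSpectrum_mul hX l θ)
    rwa [ENNReal.toReal_add (hfin θ) (ENNReal.mul_ne_top ENNReal.ofReal_ne_top (hfin l)),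
      ENNReal.toReal_mul, ENNReal.toReal_ofReal θ.2.1.le] at this
  · have hmul := ENNReal.mul_ne_top ENNReal.ofReal_ne_top (hfin l) (a := ENNReal.ofReal θ)
    have := ENNReal.toReal_mono (ENNReal.add_ne_top.2 ⟨ENNReal.ofReal_ne_top, hmul⟩)
      (normalizedLowerSpectrum_mul_le hX l θ)
    rwa [ENNReal.toReal_add ENNReal.ofReal_ne_top hmul, ENNReal.toReal_mul,
      ENNReal.toReal_ofReal (hnonneg θ), ENNReal.toReal_ofReal θ.2.1.le] at this

theorem normalizedLowerSpectrum_eq_of_bilipschitz [Nonempty X] (hX : IsAssouadExponent X α)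
    {f : X → Y} {K K' : ℝ≥0} (hK : 0 < K) (hK' : 0 < K') (hf : LipschitzWith K f)
    (hf' : AntilipschitzWith K' f) (hsurj : Function.Surjective f) (θ : Ioc (0 : ℝ) 1) :
    normalizedLowerSpectrum Y θ = normalizedLowerSpectrum X θ := by
  have : Nonempty Y := ‹Nonempty X›.map f
  set g := Function.surjInv hsurj
  have hgf : Function.LeftInverse g f := Function.leftInverse_surjInv ⟨hf'.injective, hsurj⟩
  have hfg : Function.RightInverse g f := Function.rightInverse_surjInv hsurj
  have hg : LipschitzWith K' g := hf'.to_rightInverse hfg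
  have hg' : AntilipschitzWith K g := hf.to_rightInverse hfg
  have hY : IsAssouadExponent Y α := hX.of_bilipschitz hg hg'
  refine normalizedLowerSpectrum_congr fun t => ⟨fun h => ?_, fun h => ?_⟩
  · exact (h.rescale hY θ.2.1 one_pos (by positivity) one_pos (by positivity)).of_bilipschitz
      hK' hg hg' hgf.surjective
  · exact (h.rescale hX θ.2.1 one_pos (by positivity) one_pos (by positivity)).of_bilipschitz
      hK hf hf' hsurj

theorem normalizedLowerSpectrum_pi [Nonempty X] {ι : Type*} [Fintype ι] [Nonempty ι]
    (hX : IsAssouadExponent X α) (θ : Ioc (0 : ℝ) 1) :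
    normalizedLowerSpectrum (ι → X) θ = Fintype.card ι * normalizedLowerSpectrum X θ := by
  have hcard : (Fintype.card ι : ℝ) ≠ 0 := Nat.cast_ne_zero.2 Fintype.card_ne_zero
  apply le_antisymm
  · rw [normalizedLowerSpectrum_eq_iSup]
    refine iSup₂_le fun t ht => ?_
    calc (t : ℝ≥0∞) = ENNReal.ofReal (Fintype.card ι * (t / Fintype.card ι)) := by
          rw [mul_div_cancel₀ _ hcard, ENNReal.ofReal_coe_nnreal]
      _ = Fintype.card ι * ENNReal.ofReal (t / Fintype.card ι) := by
          rw [ENNReal.ofReal_mul (Nat.cast_nonneg _), ENNReal.ofReal_natCast]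
      _ ≤ Fintype.card ι * normalizedLowerSpectrum X θ := by
          gcongr
          exact ht.of_pi.ofReal_le
  · simp only [normalizedLowerSpectrum_eq_iSup θ (X := X), ENNReal.mul_iSup]
    refine iSup₂_le fun t ht => ?_
    have := ((ht.rescale hX θ.2.1 one_pos two_pos one_pos one_pos).pi (ι := ι) hX).ofReal_le
    rwa [ENNReal.ofReal_mul (Nat.cast_nonneg _), ENNReal.ofReal_natCast,
      ENNReal.ofReal_coe_nnreal] at this

theorem normalizedLowerSpectrum_euclideanSpace_cube {ι : Type*} [Fintype ι] [Nonempty ι]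
    {S : Set ℝ} (hS : S.Nonempty) (θ : Ioc (0 : ℝ) 1) :
    normalizedLowerSpectrum {x : EuclideanSpace ℝ ι | ∀ i, x i ∈ S} θ =
      Fintype.card ι * normalizedLowerSpectrum S θ := by
  have : Nonempty S := hS.to_subtype
  set F := {x : EuclideanSpace ℝ ι | ∀ i, x i ∈ S}
  let f : F → ι → S := fun x i => ⟨x.1 i, x.2 i⟩
  have hsurj : Function.Surjective f := fun y =>
    ⟨⟨WithLp.toLp 2 fun i => (y i : ℝ), fun i => (y i).2⟩, rfl⟩
  have hf : LipschitzWith 1 f := fun x y => PiLp.lipschitzWith_ofLp 2 (fun _ : ι => ℝ) x y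
  have hf' : AntilipschitzWith _ f := fun x y => PiLp.antilipschitzWith_ofLp 2 (fun _ : ι => ℝ) x y
  have : Nonempty F := hsurj.nonempty
  rw [← normalizedLowerSpectrum_pi (isAssouadExponent_subset_real S)]
  exact (normalizedLowerSpectrum_eq_of_bilipschitz (isAssouadExponent_subset_euclideanSpace F)
    one_pos (by positivity) hf hf' hsurj θ).symm

end NormalizedLowerSpectrum

section BinaryDigits

/-- The number in `[0, 1)` whose binary digits equal to `1` are those at the positions in `T`, the
first digit after the binary point being at position `0`. -/
noncomputable def binaryValue (T : Finset ℕ) : ℝ := ∑ i ∈ T, (1 / 2 : ℝ) ^ (i + 1)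

variable {T U : Finset ℕ} {j m n : ℕ}

theorem binaryValue_nonneg (T : Finset ℕ) : 0 ≤ binaryValue T :=
  Finset.sum_nonneg fun _ _ => by positivity

theorem half_pow_le_binaryValue {i : ℕ} (hi : i ∈ T) : (1 / 2 : ℝ) ^ (i + 1) ≤ binaryValue T :=
  Finset.single_le_sum (f := fun i => (1 / 2 : ℝ) ^ (i + 1)) (fun _ _ => by positivity) hi

theorem sum_Ico_half_pow (hmn : m ≤ n) :
    ∑ i ∈ Finset.Ico m n, (1 / 2 : ℝ) ^ (i + 1) = (1 / 2) ^ m - (1 / 2) ^ n := by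
  rw [← neg_inj, neg_sub, ← Finset.sum_Ico_sub (fun i => (1 / 2 : ℝ) ^ i) hmn,
    ← Finset.sum_neg_distrib]
  exact Finset.sum_congr rfl fun i _ => by ring

theorem binaryValue_le_sub (hmn : m ≤ n) (hT : T ⊆ Finset.Ico m n) :
    binaryValue T ≤ (1 / 2) ^ m - (1 / 2) ^ n := by
  rw [← sum_Ico_half_pow hmn]
  exact Finset.sum_le_sum_of_subset_of_nonneg hT fun _ _ _ => by positivity

theorem binaryValue_lt (hT : ∀ i ∈ T, n ≤ i) : binaryValue T < (1 / 2) ^ n := by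
  have hsub : T ⊆ Finset.Ico n (n + T.sup id + 1) := fun i hi => by
    have := Finset.le_sup (f := id) hi
    simp only [id, Finset.mem_Ico] at this ⊢
    exact ⟨hT i hi, by omega⟩
  exact (binaryValue_le_sub (by omega) hsub).trans_lt (sub_lt_self _ (by positivity))

theorem binaryValue_sub_binaryValue (T U : Finset ℕ) :
    binaryValue T - binaryValue U = binaryValue (T \ U) - binaryValue (U \ T) :=
  Finset.sum_sdiff_sub_sum_sdiff.symm

theorem abs_binaryValue_sub_le (h : ∀ i < n, i ∈ T ↔ i ∈ U) :
    |binaryValue T - binaryValue U| ≤ (1 / 2) ^ n := by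
  rw [binaryValue_sub_binaryValue]
  refine abs_sub_le_of_nonneg_of_le (binaryValue_nonneg _) (binaryValue_lt fun i hi => ?_).le
    (binaryValue_nonneg _) (binaryValue_lt fun i hi => ?_).le
  all_goals
    by_contra! hin
    simp [h i hin] at hi

theorem half_pow_le_abs_binaryValue_sub (hT : T ⊆ Finset.range n) (hU : U ⊆ Finset.range n)
    (hne : T ≠ U) : (1 / 2 : ℝ) ^ n ≤ |binaryValue T - binaryValue U| := by
  obtain ⟨i, hi, hmin⟩ := (symmDiff T U).exists_min_image id
    (Finset.nonempty_iff_ne_empty.2 (symmDiff_eq_bot.not.2 hne))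
  wlog hiT : i ∈ T \ U generalizing T U
  · rw [abs_sub_comm]
    rw [symmDiff_comm] at hi hmin
    exact this hU hT hne.symm hi hmin
      ((Finset.mem_union.1 hi).resolve_right hiT)
  have hin : i < n := Finset.mem_range.1 (hT (Finset.mem_sdiff.1 hiT).1)
  have hsub : U \ T ⊆ Finset.Ico (i + 1) n := fun l hl => by
    have hil : i ≤ l := hmin l (Finset.mem_union_right _ hl)
    have hne : l ≠ i := fun h => (Finset.mem_sdiff.1 hl).2 (h ▸ (Finset.mem_sdiff.1 hiT).1)
    have := Finset.mem_range.1 (hU (Finset.mem_sdiff.1 hl).1)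
    exact Finset.mem_Ico.2 ⟨by omega, this⟩
  rw [binaryValue_sub_binaryValue]
  refine le_trans ?_ (le_abs_self _)
  linarith [half_pow_le_binaryValue hiT, binaryValue_le_sub (m := i + 1) hin hsub]

theorem two_pow_card_le_ballCoverNumber {S : Set ℝ} {s : ℝ} (hT : s + binaryValue T ∈ S)
    {A B : Finset ℕ} (hAB : Disjoint A B) (hA : A ⊆ Finset.range n) (hB : B ⊆ Finset.Ico j n)
    (hAT : ∀ i < j, i ∈ A ↔ i ∈ T) (hS : ∀ U ⊆ B, s + binaryValue (A ∪ U) ∈ S)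
    {r ρ : ℝ≥0} (hr : 2 * r < (1 / 2) ^ n) (hρ : (1 / 2) ^ j ≤ ρ) :
    (2 : ℝ≥0∞) ^ B.card ≤ ballCoverNumber r (⟨_, hT⟩ : S) ρ := by
  have hsub (U : B.powerset) : U.1 ⊆ B := Finset.mem_powerset.1 U.2
  have hrange (U : B.powerset) : A ∪ U ⊆ Finset.range n :=
    Finset.union_subset hA (((hsub U).trans hB).trans fun i hi =>
      Finset.mem_range.2 (Finset.mem_Ico.1 hi).2)
  have hinj {U V : B.powerset} (h : A ∪ U.1 = A ∪ V.1) : U = V := by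
    have hdisj (W : B.powerset) : Disjoint A W.1 := hAB.mono_right (hsub W)
    rw [Subtype.ext_iff, ← Finset.union_sdiff_cancel_left (hdisj U), h,
      Finset.union_sdiff_cancel_left (hdisj V)]
  have hagree (U : B.powerset) : ∀ i < j, i ∈ A ∪ U.1 ↔ i ∈ T := fun i hi => by
    have : i ∉ U.1 := fun h => hi.not_ge (Finset.mem_Ico.1 (hB (hsub U h))).1
    rw [Finset.mem_union, or_iff_left this, hAT i hi]
  let p : B.powerset → S := fun U => ⟨_, hS U.1 (hsub U)⟩
  have hball (U : B.powerset) : p U ∈ closedBall ⟨_, hT⟩ (ρ : ℝ) := by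
    rw [mem_closedBall, Subtype.dist_eq, Real.dist_eq, add_sub_add_left_eq_sub]
    exact (abs_binaryValue_sub_le (hagree U)).trans (by exact_mod_cast hρ)
  have hsep : Pairwise fun U V => 2 * r < nndist (p U) (p V) := fun U V hUV => by
    refine hr.trans_le (NNReal.coe_le_coe.1 ?_)
    rw [coe_nndist, Subtype.dist_eq, Real.dist_eq, add_sub_add_left_eq_sub]
    exact_mod_cast half_pow_le_abs_binaryValue_sub (hrange U) (hrange V) fun h => hUV (hinj h)
  simpa using card_le_ballCoverNumber hball hsep

end BinaryDigits

section BlockSet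

/-- The digit positions in `[j, n)` at which the counting function `c` increases; the subsets of
this set are the admissible digit patterns between the scales `2 ^ (-j)` and `2 ^ (-n)`. -/
def branchPositions (c : ℕ → ℕ) (j n : ℕ) : Finset ℕ := {i ∈ Finset.Ico j n | c i < c (i + 1)}

theorem mem_branchPositions {c : ℕ → ℕ} {i j n : ℕ} :
    i ∈ branchPositions c j n ↔ (j ≤ i ∧ i < n) ∧ c i < c (i + 1) := by
  simp only [branchPositions, Finset.mem_filter, Finset.mem_Ico]

theorem card_branchPositions {c : ℕ → ℕ} (hmono : Monotone c) (hstep : ∀ n, c (n + 1) ≤ c n + 1)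
    {j n : ℕ} (hjn : j ≤ n) : (branchPositions c j n).card = c n - c j := by
  rw [branchPositions, Finset.card_filter]
  induction n, hjn using Nat.le_induction with
  | base => simp
  | succ n hjn ih =>
    have := hmono hjn
    have : c n ≤ c (n + 1) := hmono n.le_succ
    have := hstep n
    rw [Finset.sum_Ico_succ_top hjn, ih]
    split_ifs <;> omega

/-- The finite digit sets allowed in the `k`-th block: arbitrary ones as soon as one of the first
`k` digits is used, otherwise only digits at positions where `c` increases. -/
def IsBlockDigits (c : ℕ → ℕ) (k : ℕ) (T : Finset ℕ) : Prop :=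
  (∃ i ∈ T, i < k) ∨ ∀ i ∈ T, c i < c (i + 1)

/-- The union over `k ≥ 1` of blocks placed in `[2 * k, 2 * k + 1)`. At scale `2 ^ (-k)` around its
left end the `k`-th block branches according to `c k`, elsewhere it is dense in an interval. -/
def blockSet (c : ℕ → ℕ → ℕ) : Set ℝ :=
  {x | ∃ k : ℕ, 0 < k ∧ ∃ T, IsBlockDigits (c k) k T ∧ 2 * k + binaryValue T = x}

theorem two_mul_mem_blockSet (c : ℕ → ℕ → ℕ) {k : ℕ} (hk : 0 < k) : (2 * k : ℝ) ∈ blockSet c :=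
  ⟨k, hk, ∅, .inr (by simp), by simp [binaryValue]⟩

variable {c : ℕ → ℕ → ℕ}

section

variable {j k n : ℕ} {T : Finset ℕ} (hT : 2 * k + binaryValue T ∈ blockSet c) {r ρ : ℝ≥0}

theorem two_pow_le_ballCoverNumber_blockSet_of_exists_lt (hk : 0 < k)
    (hlt : ∃ i ∈ insert j {i ∈ T | i < j}, i < k) (hr : 2 * r < (1 / 2) ^ n)
    (hρ : (1 / 2) ^ j ≤ ρ) (hjn : j < n) :
    (2 : ℝ≥0∞) ^ (n - (j + 1)) ≤ ballCoverNumber r (⟨_, hT⟩ : blockSet c) ρ := by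
  obtain ⟨i, hi, hik⟩ := hlt
  rw [← Nat.card_Ico]
  refine two_pow_card_le_ballCoverNumber (A := insert j {i ∈ T | i < j}) (j := j) hT ?_ ?_
    (Finset.Ico_subset_Ico_left j.le_succ) (fun i hij => ?_)
    (fun U _ => ⟨k, hk, _, .inl ⟨i, Finset.mem_union_left _ hi, hik⟩, rfl⟩) hr hρ
  · simp only [Finset.disjoint_left, Finset.mem_insert, Finset.mem_filter, Finset.mem_Ico]
    lia
  · simp only [Finset.subset_iff, Finset.mem_insert, Finset.mem_filter, Finset.mem_range]
    lia
  · simp only [Finset.mem_insert, Finset.mem_filter, hij, hij.ne, and_true, false_or]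

theorem two_pow_le_ballCoverNumber_blockSet_of_forall_lt (hmono : Monotone (c k))
    (hstep : ∀ n, c k (n + 1) ≤ c k n + 1) (hk : 0 < k)
    (hbranch : ∀ i ∈ T, c k i < c k (i + 1)) (hr : 2 * r < (1 / 2) ^ n) (hρ : (1 / 2) ^ j ≤ ρ)
    (hjn : j ≤ n) :
    (2 : ℝ≥0∞) ^ (c k n - c k j) ≤ ballCoverNumber r (⟨_, hT⟩ : blockSet c) ρ := by
  rw [← card_branchPositions hmono hstep hjn]
  refine two_pow_card_le_ballCoverNumber (A := {i ∈ T | i < j}) (B := branchPositions (c k) j n)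
    hT ?_ ?_ (Finset.filter_subset _ _)
    (fun i hij => by simp only [Finset.mem_filter, hij, and_true])
    (fun U hU => ⟨k, hk, _, .inr fun i hi => ?_, rfl⟩) hr hρ
  · simp only [Finset.disjoint_left, Finset.mem_filter, mem_branchPositions]
    lia
  · simp only [Finset.subset_iff, Finset.mem_filter, Finset.mem_range]
    lia
  · rcases Finset.mem_union.1 hi with hi | hi
    · exact hbranch i (Finset.mem_filter.1 hi).1
    · exact (mem_branchPositions.1 (hU hi)).2

end

theorem two_pow_le_ballCoverNumber_blockSet (hmono : ∀ k, 0 < k → Monotone (c k))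
    (hstep : ∀ k, 0 < k → ∀ n, c k (n + 1) ≤ c k n + 1) {j n : ℕ} (hjn : j < n) (x : blockSet c)
    {r ρ : ℝ≥0} (hr : 2 * r < (1 / 2) ^ n) (hρ : (1 / 2) ^ j ≤ ρ) :
    (2 : ℝ≥0∞) ^ (n - (j + 1)) ≤ ballCoverNumber r x ρ ∨
      ∃ k, 0 < k ∧ k ≤ j ∧ (2 : ℝ≥0∞) ^ (c k n - c k j) ≤ ballCoverNumber r x ρ := by
  obtain ⟨_, k, hk, T, hT, rfl⟩ := x
  by_cases hlt : ∃ i ∈ insert j {i ∈ T | i < j}, i < k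
  · exact .inl (two_pow_le_ballCoverNumber_blockSet_of_exists_lt _ hk hlt hr hρ hjn)
  · push Not at hlt
    have hkj : k ≤ j := hlt j (Finset.mem_insert_self _ _)
    have hbranch : ∀ i ∈ T, c k i < c k (i + 1) := hT.resolve_left fun ⟨i, hi, hik⟩ =>
      hik.not_ge (hlt i (Finset.mem_insert_of_mem
        (Finset.mem_filter.2 ⟨hi, hik.trans_le hkj⟩)))
    exact .inr ⟨k, hk, hkj, two_pow_le_ballCoverNumber_blockSet_of_forall_lt _ (hmono k hk)
      (hstep k hk) hk hbranch hr hρ hjn.le⟩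

theorem exists_eq_of_mem_blockSet_of_abs_sub_le {k : ℕ} {y : ℝ} (hy : y ∈ blockSet c)
    (hyk : |y - 2 * k| ≤ (1 / 2) ^ (k + 1)) :
    ∃ T : Finset ℕ, (∀ i ∈ T, k ≤ i ∧ c k i < c k (i + 1)) ∧ 2 * k + binaryValue T = y := by
  obtain ⟨l, -, T, hT, rfl⟩ := hy
  have hT0 := binaryValue_nonneg T
  have hT1 : binaryValue T < 1 := by simpa using binaryValue_lt (T := T) (n := 0) (by simp)
  have hpow : (1 / 2 : ℝ) ^ (k + 1) ≤ 1 / 2 :=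
    pow_le_of_le_one (by norm_num) (by norm_num) k.succ_ne_zero
  have hyk' := abs_le.1 hyk
  obtain rfl : l = k := by
    have h1 : (l : ℝ) < k + 1 := by linarith
    have h2 : (k : ℝ) < l + 1 := by linarith
    norm_cast at h1 h2
    omega
  have hle : ∀ i ∈ T, l ≤ i := fun i hi => by
    by_contra! hil
    have h1 := half_pow_le_binaryValue hi
    have h2 : (1 / 2 : ℝ) ^ (l + 1) < (1 / 2) ^ (i + 1) :=
      pow_lt_pow_right_of_lt_one₀ (by norm_num) (by norm_num) (by omega)
    linarith
  have hbranch := hT.resolve_left fun ⟨i, hi, hil⟩ => hil.not_ge (hle i hi)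
  exact ⟨T, fun i hi => ⟨hle i hi, hbranch i hi⟩, rfl⟩

theorem ballCoverNumber_blockSet_le {k n : ℕ} (hmono : Monotone (c k))
    (hstep : ∀ n, c k (n + 1) ≤ c k n + 1) (hk : 0 < k) (hkn : k ≤ n) :
    ballCoverNumber ((1 / 2) ^ n) (⟨_, two_mul_mem_blockSet c hk⟩ : blockSet c)
      ((1 / 2) ^ (k + 1)) ≤ 2 ^ (c k n - c k k) := by
  let p : (branchPositions (c k) k n).powerset → blockSet c := fun U =>
    ⟨2 * k + binaryValue U, k, hk, U, .inr fun i hi =>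
      (mem_branchPositions.1 (Finset.mem_powerset.1 U.2 hi)).2, rfl⟩
  have hcover : IsCover ((1 / 2) ^ n) (closedBall (⟨_, two_mul_mem_blockSet c hk⟩ : blockSet c)
      (((1 / 2) ^ (k + 1) : ℝ≥0) : ℝ)) (range p) := by
    intro y hy
    rw [mem_closedBall, Subtype.dist_eq, Real.dist_eq] at hy
    obtain ⟨T, hT, hTy⟩ := exists_eq_of_mem_blockSet_of_abs_sub_le y.2 (by simpa using hy)
    refine ⟨_, ⟨⟨T.filter (· < n), ?_⟩, rfl⟩, ?_⟩
    · refine Finset.mem_powerset.2 fun i hi => ?_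
      obtain ⟨hiT, hin⟩ := Finset.mem_filter.1 hi
      exact mem_branchPositions.2 ⟨⟨(hT i hiT).1, hin⟩, (hT i hiT).2⟩
    · refine edist_le_coe.2 (NNReal.coe_le_coe.1 ?_)
      rw [coe_nndist, Subtype.dist_eq, Real.dist_eq, ← hTy, add_sub_add_left_eq_sub]
      exact_mod_cast abs_binaryValue_sub_le (n := n) fun i hi => by simp [hi]
  calc _ ≤ ((range p).encard : ℝ≥0∞) :=
        ENat.toENNReal_le.2 hcover.externalCoveringNumber_le_encard
    _ ≤ (2 ^ (c k n - c k k) : ℕ) := by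
        rw [← card_branchPositions hmono hstep hkn, ← Finset.card_powerset,
          ← ENat.toENNReal_coe, ← image_univ]
        refine ENat.toENNReal_le.2 ((encard_image_le _ _).trans_eq ?_)
        rw [encard_univ, ENat.card_eq_coe_fintype_card, Fintype.card_coe]
    _ = 2 ^ (c k n - c k k) := by norm_cast

end BlockSet

section Profile

/-- The inequalities defining `classH α`, for a function of a real variable that is only considered
on `(0, 1]`. -/
structure IsSpectrumProfile (α : ℝ) (f : ℝ → ℝ) : Prop where
  nonneg {θ : ℝ} : θ ∈ Ioc 0 1 → 0 ≤ f θ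
  add_mul_le {l θ : ℝ} : l ∈ Ioc 0 1 → θ ∈ Ioc 0 1 → f θ + θ * f l ≤ f (l * θ)
  mul_le {l θ : ℝ} : l ∈ Ioc 0 1 → θ ∈ Ioc 0 1 → f (l * θ) ≤ (1 - θ) * α + θ * f l

theorem isSpectrumProfile_extend {α : ℝ} {φ : Ioc (0 : ℝ) 1 → Icc (0 : ℝ) α} (hφ : φ ∈ classH α) :
    IsSpectrumProfile α (Function.extend Subtype.val (fun θ => (φ θ : ℝ)) 0) := by
  have hval (θ : Ioc (0 : ℝ) 1) :
      Function.extend Subtype.val (fun θ => (φ θ : ℝ)) 0 (θ : ℝ) = φ θ :=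
    Subtype.val_injective.extend_apply _ _ θ
  refine ⟨fun {θ} hθ => ?_, fun {l θ} hl hθ => ?_, fun {l θ} hl hθ => ?_⟩
  · lift θ to Ioc (0 : ℝ) 1 using hθ
    exact (hval θ).symm ▸ (φ θ).2.1
  · lift θ to Ioc (0 : ℝ) 1 using hθ
    lift l to Ioc (0 : ℝ) 1 using hl
    rw [hval, hval, ← Ioc.coe_mul, hval]
    exact hφ.1 l θ
  · lift θ to Ioc (0 : ℝ) 1 using hθ
    lift l to Ioc (0 : ℝ) 1 using hl
    rw [hval, ← Ioc.coe_mul, hval]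
    exact hφ.2 l θ

/-- The homogeneous function of two scales `u ≤ v` associated with `f`, in which the inequalities
of `IsSpectrumProfile` become superadditivity and the Lipschitz property along chains of scales. -/
noncomputable def scaleGrowth (f : ℝ → ℝ) (u v : ℝ) : ℝ := v * f (u / v)

theorem scaleGrowth_div (f : ℝ → ℝ) {u : ℝ} (hu : u ≠ 0) (θ : ℝ) :
    scaleGrowth f u (u / θ) = u / θ * f θ := by
  rw [scaleGrowth, div_div_cancel₀ hu]

theorem div_mem_Ioc_zero_one {u v : ℝ} (hu : 0 < u) (huv : u ≤ v) : u / v ∈ Ioc (0 : ℝ) 1 :=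
  ⟨div_pos hu (hu.trans_le huv), div_le_one_of_le₀ huv (hu.le.trans huv)⟩

namespace IsSpectrumProfile

variable {α : ℝ} {f : ℝ → ℝ} {u v w : ℝ}

theorem div_const {c : ℝ} (hc : 0 ≤ c) (h : IsSpectrumProfile α f) :
    IsSpectrumProfile (α / c) fun θ => f θ / c where
  nonneg hθ := div_nonneg (h.nonneg hθ) hc
  add_mul_le {l θ} hl hθ := by
    rw [← mul_div_assoc, ← add_div]
    gcongr
    exact h.add_mul_le hl hθ
  mul_le {l θ} hl hθ := by
    rw [← mul_div_assoc, ← mul_div_assoc, ← add_div]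
    gcongr
    exact h.mul_le hl hθ

theorem le {θ : ℝ} (h : IsSpectrumProfile α f) (hθ : θ ∈ Ioc 0 1) : f θ ≤ (1 - θ) * α := by
  have hone : (1 : ℝ) ∈ Ioc 0 1 := ⟨one_pos, le_rfl⟩
  have hf1 : f 1 ≤ 0 := by simpa using h.add_mul_le hone hone
  have := h.mul_le hone hθ
  rw [one_mul] at this
  linarith [mul_nonpos_of_nonneg_of_nonpos hθ.1.le hf1]

theorem scaleGrowth_nonneg (h : IsSpectrumProfile α f) (hu : 0 < u) (huv : u ≤ v) :
    0 ≤ scaleGrowth f u v :=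
  mul_nonneg (hu.le.trans huv) (h.nonneg (div_mem_Ioc_zero_one hu huv))

theorem scaleGrowth_add_le (h : IsSpectrumProfile α f) (hu : 0 < u) (huv : u ≤ v) (hvw : v ≤ w) :
    scaleGrowth f u v + scaleGrowth f v w ≤ scaleGrowth f u w := by
  have hv := hu.trans_le huv
  have hw := hv.trans_le hvw
  have hsuper := h.add_mul_le (div_mem_Ioc_zero_one hu huv) (div_mem_Ioc_zero_one hv hvw)
  rw [div_mul_div_cancel₀ hv.ne'] at hsuper
  calc scaleGrowth f u v + scaleGrowth f v w = w * (f (v / w) + v / w * f (u / v)) := by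
        unfold scaleGrowth
        field_simp
        ring
    _ ≤ scaleGrowth f u w := mul_le_mul_of_nonneg_left hsuper hw.le

theorem scaleGrowth_mono (h : IsSpectrumProfile α f) (hu : 0 < u) (huv : u ≤ v) (hvw : v ≤ w) :
    scaleGrowth f u v ≤ scaleGrowth f u w := by
  linarith [h.scaleGrowth_add_le hu huv hvw, h.scaleGrowth_nonneg (hu.trans_le huv) hvw]

theorem scaleGrowth_le_add (h : IsSpectrumProfile α f) (hu : 0 < u) (huv : u ≤ v) (hvw : v ≤ w) :
    scaleGrowth f u w ≤ scaleGrowth f u v + (w - v) * α := by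
  have hv := hu.trans_le huv
  have hw := hv.trans_le hvw
  have hlip := h.mul_le (div_mem_Ioc_zero_one hu huv) (div_mem_Ioc_zero_one hv hvw)
  rw [div_mul_div_cancel₀ hv.ne'] at hlip
  calc scaleGrowth f u w ≤ w * ((1 - v / w) * α + v / w * f (u / v)) :=
        mul_le_mul_of_nonneg_left hlip hw.le
    _ = scaleGrowth f u v + (w - v) * α := by
        unfold scaleGrowth
        field_simp
        ring

end IsSpectrumProfile

/-- The number of digit positions below `n` at which the `k`-th block branches. The growth function
is only meaningful above scale `k`, whence the truncation. -/
noncomputable def branchCount (f : ℝ → ℝ) (k n : ℕ) : ℕ := ⌊scaleGrowth f k (max n k)⌋₊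

variable {f : ℝ → ℝ} {j k n : ℕ}

theorem branchCount_of_le (hkn : k ≤ n) : branchCount f k n = ⌊scaleGrowth f k n⌋₊ := by
  rw [branchCount, max_eq_left (Nat.cast_le.2 hkn)]

namespace IsSpectrumProfile

theorem monotone_branchCount {α : ℝ} (h : IsSpectrumProfile α f) (hk : 0 < k) :
    Monotone (branchCount f k) := fun _ _ hmn =>
  Nat.floor_le_floor (h.scaleGrowth_mono (Nat.cast_pos.2 hk) (le_max_right _ _)
    (max_le_max_right _ (Nat.cast_le.2 hmn)))

theorem branchCount_succ_le (h : IsSpectrumProfile 1 f) (hk : 0 < k) (n : ℕ) :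
    branchCount f k (n + 1) ≤ branchCount f k n + 1 := by
  have hk' : (0 : ℝ) < k := Nat.cast_pos.2 hk
  have hkn : (k : ℝ) ≤ max (n : ℝ) k := le_max_right _ _
  have hstep : max ((n + 1 : ℕ) : ℝ) k ≤ max (n : ℝ) k + 1 := by
    push_cast
    exact max_le (by gcongr; exact le_max_left _ _) (hkn.trans (lt_add_one _).le)
  have hsucc := h.scaleGrowth_le_add hk' hkn
    (max_le_max_right _ (Nat.cast_le.2 n.le_succ) : max (n : ℝ) k ≤ max ((n + 1 : ℕ) : ℝ) k)
  rw [branchCount, branchCount, ← Nat.floor_add_one (h.scaleGrowth_nonneg hk' hkn)]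
  exact Nat.floor_le_floor (by linarith)

theorem scaleGrowth_le_branchCount_sub {α : ℝ} (h : IsSpectrumProfile α f) (hk : 0 < k)
    (hkj : k ≤ j) (hjn : j ≤ n) :
    scaleGrowth f j n ≤ (branchCount f k n - branchCount f k j : ℕ) + 1 := by
  have hk' : (0 : ℝ) < k := Nat.cast_pos.2 hk
  have hkj' : (k : ℝ) ≤ j := Nat.cast_le.2 hkj
  rw [Nat.cast_sub (h.monotone_branchCount hk hjn), branchCount_of_le hkj,
    branchCount_of_le (hkj.trans hjn)]
  have := h.scaleGrowth_add_le hk' hkj' (Nat.cast_le.2 hjn : (j : ℝ) ≤ n)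
  have := Nat.floor_le (h.scaleGrowth_nonneg hk' hkj')
  have := Nat.lt_floor_add_one (scaleGrowth f k n)
  linarith

theorem branchCount_ceil_div_le (h : IsSpectrumProfile 1 f) {θ : ℝ} (hθ : θ ∈ Ioc 0 1)
    (hk : 0 < k) : (branchCount f k ⌈k / θ⌉₊ : ℝ) ≤ k / θ * f θ + 1 := by
  have hk' : (0 : ℝ) < k := Nat.cast_pos.2 hk
  have hkθ : (k : ℝ) ≤ k / θ := le_div_self hk'.le hθ.1 hθ.2
  have hn : k / θ ≤ ⌈k / θ⌉₊ := Nat.le_ceil _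
  rw [branchCount_of_le (by exact_mod_cast hkθ.trans hn)]
  calc (⌊scaleGrowth f k ⌈k / θ⌉₊⌋₊ : ℝ) ≤ scaleGrowth f k ⌈k / θ⌉₊ :=
        Nat.floor_le (h.scaleGrowth_nonneg hk' (hkθ.trans hn))
    _ ≤ scaleGrowth f k (k / θ) + (⌈k / θ⌉₊ - k / θ) * 1 := h.scaleGrowth_le_add hk' hkθ hn
    _ ≤ k / θ * f θ + 1 := by
      rw [scaleGrowth_div f hk'.ne']
      linarith [Nat.ceil_lt_add_one (hk'.le.trans hkθ)]

end IsSpectrumProfile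

end Profile

section Realization

variable {f : ℝ → ℝ} {θ t : ℝ}

theorem half_rpow_rpow_neg (a u : ℝ) : ((1 / 2 : ℝ≥0) ^ a) ^ (-u) = 2 ^ (a * u) := by
  rw [← NNReal.rpow_mul, one_div, NNReal.inv_rpow, ← NNReal.rpow_neg, mul_neg, neg_neg]

theorem half_mul_half_rpow_rpow_neg_le {a u : ℝ} {N : ℕ} (h : a * u ≤ N + 1) :
    ((1 / 2 * ((1 / 2) ^ a) ^ (-u) : ℝ≥0) : ℝ≥0∞) ≤ 2 ^ N := by
  have hpow : (2 : ℝ≥0) ^ (a * u) ≤ 2 * 2 ^ N := by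
    rw [← pow_succ', ← NNReal.rpow_natCast]
    exact NNReal.rpow_le_rpow_of_exponent_le one_le_two (by exact_mod_cast h)
  rw [half_rpow_rpow_neg, ← ENNReal.coe_two, ← ENNReal.coe_pow, ENNReal.coe_le_coe, one_div,
    inv_mul_le_iff₀ two_pos]
  exact hpow

theorem half_mul_rpow_neg_le_ballCoverNumber_blockSet (h : IsSpectrumProfile 1 f)
    (hθ : θ ∈ Ioc 0 1) {j n : ℕ} (hjn : j / θ + 1 ≤ n) (x : blockSet (branchCount f))
    {r ρ : ℝ≥0} (hr : 2 * r < (1 / 2) ^ n) (hρ : (1 / 2) ^ j ≤ ρ) :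
    ((1 / 2 * ((1 / 2) ^ (j / θ)) ^ (-f θ) : ℝ≥0) : ℝ≥0∞) ≤ ballCoverNumber r x ρ := by
  have hjθ : (j : ℝ) ≤ j / θ := le_div_self j.cast_nonneg hθ.1 hθ.2
  have hjn' : j + 1 ≤ n := by exact_mod_cast (add_le_add_left hjθ 1).trans hjn
  rcases two_pow_le_ballCoverNumber_blockSet (fun k hk => h.monotone_branchCount hk)
    (fun k hk => h.branchCount_succ_le hk) hjn' x hr hρ with hN | ⟨k, hk, hkj, hN⟩
  · refine (half_mul_half_rpow_rpow_neg_le ?_).trans hN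
    calc j / θ * f θ ≤ j / θ * ((1 - θ) * 1) :=
          mul_le_mul_of_nonneg_left (h.le hθ) (j.cast_nonneg.trans hjθ)
      _ = j / θ - j := by
          have := hθ.1.ne'
          field_simp
      _ ≤ (n - (j + 1) : ℕ) + 1 := by
          push_cast [hjn']
          linarith
  · have hj : (0 : ℝ) < j := Nat.cast_pos.2 (hk.trans_le hkj)
    refine (half_mul_half_rpow_rpow_neg_le ?_).trans hN
    calc j / θ * f θ = scaleGrowth f j (j / θ) := (scaleGrowth_div f hj.ne' θ).symm
      _ ≤ scaleGrowth f j n := h.scaleGrowth_mono hj hjθ (by linarith)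
      _ ≤ (branchCount f k n - branchCount f k j : ℕ) + 1 :=
          h.scaleGrowth_le_branchCount_sub hk hkj (Nat.le_of_succ_le hjn')

theorem isLowerExponent_blockSet (h : IsSpectrumProfile 1 f) (hθ : θ ∈ Ioc 0 1) :
    IsLowerExponent (blockSet (branchCount f)) 1 1 θ (f θ) := by
  refine IsLowerExponent.rescale (a := (1 / 2) ^ (θ⁻¹ + 3)) (b := 1)
    (isAssouadExponent_subset_real _) hθ.1 (by positivity) one_pos one_pos one_pos
    ⟨1 / 2, by norm_num, fun r hr hr1 x => ?_⟩
  obtain ⟨j, hjr, hrj⟩ := exists_nat_pow_near_of_lt_one hr hr1.le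
    (by positivity : 0 < (1 / 2 : ℝ≥0) ^ θ⁻¹)
    (NNReal.rpow_lt_one (by norm_num) (inv_pos.2 hθ.1))
  simp only [← NNReal.rpow_mul_natCast, inv_mul_eq_div] at hjr hrj
  set v : ℝ := (j + 1 : ℕ) / θ with hv
  have hv0 : 0 ≤ v := div_nonneg (j + 1).cast_nonneg hθ.1.le
  have hjv : θ⁻¹ + 3 + j / θ = v + 2 + 1 := by
    rw [hv]
    push_cast
    ring
  have hscale : 2 * ((1 / 2) ^ (θ⁻¹ + 3) * r) < (1 / 2) ^ (⌈v⌉₊ + 1) := by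
    calc 2 * ((1 / 2) ^ (θ⁻¹ + 3) * r) ≤ 2 * ((1 / 2) ^ (θ⁻¹ + 3) * (1 / 2) ^ (j / θ)) := by gcongr
      _ = (1 / 2) ^ (v + 2) := by
        rw [← NNReal.rpow_add (by norm_num), hjv, NNReal.rpow_add_one (by norm_num)]
        field_simp
      _ < (1 / 2) ^ (⌈v⌉₊ + 1) := by
        rw [← NNReal.rpow_natCast]
        refine NNReal.rpow_lt_rpow_of_exponent_gt (by norm_num) (by norm_num) ?_
        push_cast
        linarith [Nat.ceil_lt_add_one hv0]
  have hball : (1 / 2) ^ (j + 1) ≤ 1 * r ^ θ := by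
    simpa only [hv, one_mul, ← NNReal.rpow_mul, div_mul_cancel₀ _ hθ.1.ne', NNReal.rpow_natCast]
      using NNReal.rpow_le_rpow hjr.le hθ.1.le
  refine le_trans (ENNReal.coe_le_coe.2 (mul_le_mul_right ?_ _))
    (half_mul_rpow_neg_le_ballCoverNumber_blockSet h hθ ?_ x hscale hball)
  · exact NNReal.rpow_le_rpow_of_nonpos (by positivity) hjr.le (neg_nonpos.2 (h.nonneg hθ))
  · rw [Nat.cast_succ ⌈v⌉₊]
    exact add_le_add_left (Nat.le_ceil v) 1

theorem IsLowerExponent.le_of_blockSet (h : IsSpectrumProfile 1 f) (hθ : θ ∈ Ioc 0 1)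
    (ht : IsLowerExponent (blockSet (branchCount f)) 1 1 θ t) : t ≤ f θ := by
  obtain ⟨C, hC, ht⟩ := ht.rescale (a' := 1) (b' := 1 / 2) (isAssouadExponent_subset_real _) hθ.1
    one_pos one_pos one_pos (by norm_num)
  have hlim : Tendsto (fun k : ℕ => (1 / 2 : ℝ≥0) ^ (k / θ)) atTop (𝓝[>] 0) := by
    refine tendsto_nhdsWithin_iff.2 ⟨?_, Eventually.of_forall fun k => NNReal.rpow_pos (by simp)⟩
    simp only [← inv_mul_eq_div θ, NNReal.rpow_mul_natCast]
    exact NNReal.tendsto_pow_atTop_nhds_zero_of_lt_one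
      (NNReal.rpow_lt_one (by norm_num) (inv_pos.2 hθ.1))
  refine le_of_frequently_mul_rpow_neg_le (M := 2) hC (hlim.frequently (Eventually.frequently ?_))
  filter_upwards [eventually_gt_atTop 0] with k hk
  set r : ℝ≥0 := (1 / 2) ^ (k / θ) with hr
  have hk' : (0 : ℝ) < k := Nat.cast_pos.2 hk
  set n : ℕ := ⌈k / θ⌉₊
  have hn : k / θ ≤ n := Nat.le_ceil _
  have hkn : k ≤ n := by exact_mod_cast (le_div_self hk'.le hθ.1 hθ.2).trans hn
  have hle := ht r (by positivity) (NNReal.rpow_lt_one (by norm_num) (div_pos hk' hθ.1))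
    ⟨_, two_mul_mem_blockSet _ hk⟩
  have hnr : (1 / 2) ^ n ≤ 1 * r := by
    rw [one_mul, ← NNReal.rpow_natCast]
    exact NNReal.rpow_le_rpow_of_exponent_ge (by norm_num) (by norm_num) hn
  have hrθ : 1 / 2 * r ^ θ = (1 / 2) ^ (k + 1) := by
    rw [hr, ← NNReal.rpow_mul, div_mul_cancel₀ _ hθ.1.ne', NNReal.rpow_natCast, pow_succ']
  have hN := hle.trans ((ballCoverNumber_mono hnr hrθ.le _).trans
    (ballCoverNumber_blockSet_le (h.monotone_branchCount hk) (h.branchCount_succ_le hk) hk hkn))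
  rw [← ENNReal.coe_two, ← ENNReal.coe_pow, ENNReal.coe_le_coe] at hN
  calc C * r ^ (-t) ≤ 2 ^ (branchCount f k n - branchCount f k k) := hN
    _ ≤ 2 ^ branchCount f k n := pow_le_pow_right₀ one_le_two (Nat.sub_le _ _)
    _ ≤ 2 ^ (k / θ * f θ + 1) := by
      rw [← NNReal.rpow_natCast]
      exact NNReal.rpow_le_rpow_of_exponent_le one_le_two (h.branchCount_ceil_div_le hθ hk)
    _ = 2 * r ^ (-f θ) := by
      rw [hr, half_rpow_rpow_neg, NNReal.rpow_add_one two_ne_zero, mul_comm]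

theorem normalizedLowerSpectrum_blockSet (h : IsSpectrumProfile 1 f) (θ : Ioc (0 : ℝ) 1) :
    normalizedLowerSpectrum (blockSet (branchCount f)) θ = ENNReal.ofReal (f θ) := by
  have : Nonempty (blockSet (branchCount f)) := ⟨⟨_, two_mul_mem_blockSet _ one_pos⟩⟩
  refine le_antisymm ?_ (isLowerExponent_blockSet h θ.2).ofReal_le
  rw [normalizedLowerSpectrum_eq_iSup]
  refine iSup₂_le fun t ht => ?_
  rw [← ENNReal.ofReal_coe_nnreal]
  exact ENNReal.ofReal_le_ofReal (ht.le_of_blockSet h θ.2)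

end Realization

section Euclidean

variable {d : ℕ}

theorem exists_mem_classH_of_subset_euclideanSpace {F : Set (EuclideanSpace ℝ (Fin d))}
    (hF : F.Nonempty) :
    ∃ φ ∈ classH (d : ℝ), ∀ θ, normalizedLowerSpectrum F θ = ENNReal.ofReal (φ θ) := by
  have := hF.to_subtype
  have hexp : IsAssouadExponent F d := by
    simpa only [Fintype.card_fin] using isAssouadExponent_subset_euclideanSpace F
  exact exists_mem_classH_normalizedLowerSpectrum_eq hexp d.cast_nonneg

theorem exists_normalizedLowerSpectrum_eq {φ : Ioc (0 : ℝ) 1 → Icc (0 : ℝ) (d : ℝ)}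
    (hφ : φ ∈ classH (d : ℝ)) : ∃ F : Set (EuclideanSpace ℝ (Fin d)), F.Nonempty ∧
      ∀ θ, normalizedLowerSpectrum F θ = ENNReal.ofReal (φ θ) := by
  rcases d.eq_zero_or_pos with rfl | hd
  · obtain ⟨φ', -, hφ'⟩ :=
      exists_mem_classH_of_subset_euclideanSpace (univ_nonempty (α := EuclideanSpace ℝ (Fin 0)))
    have : Subsingleton (Icc (0 : ℝ) (0 : ℕ)) := by
      rw [Nat.cast_zero, Icc_self]
      infer_instance
    exact ⟨univ, univ_nonempty, fun θ => by rw [hφ', Subsingleton.elim (φ' θ)]⟩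
  set f : ℝ → ℝ := Function.extend Subtype.val (fun θ => (φ θ : ℝ)) 0
  have hd' : (d : ℝ) ≠ 0 := Nat.cast_ne_zero.2 hd.ne'
  have hprofile : IsSpectrumProfile 1 fun θ => f θ / d := by
    simpa only [div_self hd'] using (isSpectrumProfile_extend hφ).div_const d.cast_nonneg
  have : Nonempty (Fin d) := ⟨⟨0, hd⟩⟩
  have hS : (blockSet (branchCount fun θ => f θ / d)).Nonempty :=
    ⟨_, two_mul_mem_blockSet _ one_pos⟩
  have hF : {x : EuclideanSpace ℝ (Fin d) |
      ∀ i, x i ∈ blockSet (branchCount fun θ => f θ / d)}.Nonempty :=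
    ⟨WithLp.toLp 2 fun _ => hS.some, fun _ => hS.some_mem⟩
  refine ⟨_, hF, fun θ => ?_⟩
  have hfθ : f θ = φ θ := Subtype.val_injective.extend_apply _ _ θ
  rw [normalizedLowerSpectrum_euclideanSpace_cube hS, normalizedLowerSpectrum_blockSet hprofile,
    Fintype.card_fin, ← ENNReal.ofReal_natCast, ← ENNReal.ofReal_mul d.cast_nonneg,
    mul_div_cancel₀ _ hd', hfθ]

theorem setOf_normalizedLowerSpectrum_eq_image_classH :
    {ψ | ∃ F : Set (EuclideanSpace ℝ (Fin d)), F.Nonempty ∧ ψ = normalizedLowerSpectrum F} =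
      (fun φ θ => ENNReal.ofReal (φ θ)) '' classH (d : ℝ) := by
  ext ψ
  constructor
  · rintro ⟨F, hF, rfl⟩
    obtain ⟨φ, hφ, h⟩ := exists_mem_classH_of_subset_euclideanSpace hF
    exact ⟨φ, hφ, funext fun θ => (h θ).symm⟩
  · rintro ⟨φ, hφ, rfl⟩
    obtain ⟨F, hF, h⟩ := exists_normalizedLowerSpectrum_eq hφ
    exact ⟨F, hF, funext fun θ => (h θ).symm⟩

end Euclidean

theorem mem_classH_iff {α : ℝ} {φ : Ioc (0 : ℝ) 1 → Icc (0 : ℝ) α} :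
    φ ∈ classH α ↔ ∀ l θ : Ioc (0 : ℝ) 1, (φ θ : ℝ) ≤ φ (l * θ) - θ * φ l ∧
      (φ (l * θ) : ℝ) - θ * φ l ≤ (1 - θ) * α := by
  simp only [classH, mem_ofPred_eq, ge_iff_le, le_sub_iff_add_le, sub_le_iff_le_add, forall_and]

theorem injective_ofReal_comp_Icc {ι : Type*} {α : ℝ} :
    Function.Injective fun (φ : ι → Icc (0 : ℝ) α) (i : ι) => ENNReal.ofReal (φ i) :=
  fun φ ψ h => funext fun i => Subtype.ext
    ((ENNReal.ofReal_eq_ofReal_iff (φ i).2.1 (ψ i).2.1).1 (congrFun h i))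

theorem theoremA (d : ℕ) :
    (∀ φ : Set.Ioc (0 : ℝ) 1 → Set.Icc (0 : ℝ) (d : ℝ),
      (∃ F : Set (EuclideanSpace ℝ (Fin d)), F.Nonempty ∧
        ∀ θ : Set.Ioc (0 : ℝ) 1,
          normalizedLowerSpectrum F θ = ENNReal.ofReal (φ θ : ℝ)) ↔
      ∀ l θ : Set.Ioc (0 : ℝ) 1,
        (φ θ : ℝ) ≤ (φ (l * θ) : ℝ) - (θ : ℝ) * (φ l : ℝ) ∧
        (φ (l * θ) : ℝ) - (θ : ℝ) * (φ l : ℝ) ≤ (1 - (θ : ℝ)) * (d : ℝ)) ∧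
    {ψ : Set.Ioc (0 : ℝ) 1 → ℝ≥0∞ |
      ∃ F : Set (EuclideanSpace ℝ (Fin d)), F.Nonempty ∧ ψ = normalizedLowerSpectrum F} =
    (fun (φ : Set.Ioc (0 : ℝ) 1 → Set.Icc (0 : ℝ) (d : ℝ)) (θ : Set.Ioc (0 : ℝ) 1) =>
      ENNReal.ofReal (φ θ : ℝ)) '' classH (d : ℝ) := by
  refine ⟨fun φ => ?_, setOf_normalizedLowerSpectrum_eq_image_classH⟩
  rw [← mem_classH_iff]
  refine ⟨fun ⟨F, hF, hFφ⟩ => ?_, exists_normalizedLowerSpectrum_eq⟩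
  obtain ⟨φ', hφ', hFφ'⟩ := exists_mem_classH_of_subset_euclideanSpace hF
  rwa [injective_ofReal_comp_Icc (funext fun θ => (hFφ θ).symm.trans (hFφ' θ))]
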